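/- Let $d\in\{1,2,3\}$, $\Omega=\prod_{i=1}^d(0,\ell_i)$ with $\ell_i>0$, $\varepsilon>0$, $T>0$, $f(u)=u^3-u$, and let $u$ be a classical solution on $[0,T]$ of the Allen–Cahn equation $$\partial_t u-\varepsilon^2\Delta u+f(u)=0,\qquad u(0)=u_0,$$ with periodic boundary conditions on $\Omega$, where $u(t,\cdot)$ is $C^2$ for each $t$ and $\partial_t^k u$, $0\le k\le 4$, exist and are jointly continuous on $[0,T]\times\mathbb R^d$ (one-sided time derivatives at the end points). For a grid $0=t_0<t_1<\dots<t_N=T$ put $\tau_k=t_k-t_{k-1}$, $r_k=\tau_k/\tau_{k-1}$, and define $D_3v^n=\sum_{k=1}^n b^{(n)}_{n-k}(v^k-v^{k-1})$, where $b^{(1)}_0=1/\tau_1$, $$b^{(2)}_0=\frac{1+2r_2}{\tau_2(1+r_2)},\qquad b^{(2)}_1=-\frac{r_2^2}{\tau_2(1+r_2)},$$ and, for $n\ge3$, with $\Delta_n=\tau_n(1+r_n)(1+r_{n-1})(1+r_{n-1}+r_nr_{n-1})$, $$b^{(n)}_0=\frac{(1+r_{n-1})[1+2r_n+r_{n-1}(1+4r_n+3r_n^2)]}{\Delta_n},\qquad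 b^{(n)}_1=-\frac{r_n^2[(1+2r_{n-1}+r_nr_{n-1})^2-r_{n-1}(1+r_{n-1})]}{\Delta_n},\qquad b^{(n)}_2=\frac{r_n^2r_{n-1}^3(1+r_n)^2}{\Delta_n},$$ and $b^{(n)}_j=0$ for $j\ge 3$ (BDF1 and BDF2 for the two first steps, variable-step BDF3 afterwards). Let $u^0=u_0$ and let $u^1,\dots,u^N$ be periodic $C^2$ solutions of $$D_3u^n-\varepsilon^2\Delta u^n+f(u^n)=0,\qquad 1\le n\le N .$$ Let $B$ be the lower triangular $N\times N$ matrix with entries $B_{nk}=b^{(n)}_{n-k}$ for $k\le n$, $\Lambda=\mathrm{diag}(\tau_1,\dots,\tau_N)$ and $\gamma=1/200$; for real square matrices, $P>Q$ means $x^{T}(P-Q)x>0$ for all $x\ne0$. Write $\|\cdot\|$ for the norm of $L^2(\Omega)$. (i) If $r_k\le1.405$ for $2\le k\le N$, then $B>\gamma\Lambda^{-1}$. (ii) There are constants $C>0$ and $\tau_{\max}>0$, depending only on $\Omega$, $\varepsilon$, $T$ and $u_0$ (not on $N$, the grid or $n$), such that whenever $B>\gamma\Lambda^{-1}$ and $\max_{1\le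 k\le N}\tau_k\le\tau_{\max}$, one has for all $1\le n\le N$ $$\|u(t_n)-u^n\|\le C\Biggl(\tau_1^{1/2}\int_0^{t_1}\|\partial_{tt}u\|\,dt+\tau_2^{3/2}\int_{t_1}^{t_2}\|\partial_{ttt}u\|\,dt+\tau_1\tau_2^{1/2}\int_0^{t_1}\|\partial_{ttt}u\|\,dt$$ $$\qquad+\sqrt{\sum_{k=3}^n\tau_k\Bigl(\tau_k^2\int_{t_{k-1}}^{t_k}\|\partial_{tttt}u\|\,dt+\tau_{k-1}^2\int_{t_{k-2}}^{t_{k-1}}\|\partial_{tttt}u\|\,dt+\tau_{k-2}^2\int_{t_{k-3}}^{t_{k-2}}\|\partial_{tttt}u\|\,dt\Bigr)^2}\;\Biggr),$$ where for $n=1$ the two terms with $\partial_{ttt}u$ are omitted. -/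

import Mathlib

open scoped Matrix

noncomputable section

namespace BDF3

/-! ### Time grids and the variable-step BDF kernels -/

/-- `0 = t 0 < t 1 < ⋯ < t N = T`; the values `t k` with `k > N` play no role. -/
structure IsGrid (T : ℝ) (N : ℕ) (t : ℕ → ℝ) : Prop where
  zero : t 0 = 0
  last : t N = T
  lt_succ : ∀ k, k < N → t k < t (k + 1)

/-- The time step `τ_k = t_k - t_{k-1}`, for `k ≥ 1`. -/
def step (t : ℕ → ℝ) (k : ℕ) : ℝ := t k - t (k - 1)

/-- The adjacent step ratio `r_k = τ_k / τ_{k-1}`, for `k ≥ 2`. -/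
def ratio (t : ℕ → ℝ) (k : ℕ) : ℝ := step t k / step t (k - 1)

/-- The common denominator of the BDF3 coefficients, with `r = r_n`, `q = r_{n-1}`, `s = τ_n`. -/
def den (s r q : ℝ) : ℝ := s * (1 + r) * (1 + q) * (1 + q + r * q)

/-- The BDF3 coefficients `b_0, b_1, b_2` (and `b_j = 0` for `j ≥ 3`), with `s = τ_n`,
`r = r_n`, `q = r_{n-1}`. -/
def kernel3 (s r q : ℝ) : ℕ → ℝ
  | 0 => (1 + q) * (1 + 2 * r + q * (1 + 4 * r + 3 * r ^ 2)) / den s r q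
  | 1 => -(r ^ 2 * ((1 + 2 * q + r * q) ^ 2 - q * (1 + q))) / den s r q
  | 2 => r ^ 2 * q ^ 3 * (1 + r) ^ 2 / den s r q
  | _ => 0

/-- The kernels `b_j^{(n)}`: one step of BDF1 (`n = 1`), one step of BDF2 (`n = 2`), and
variable-step BDF3 for `n ≥ 3`. Arguments: grid, `n`, `j`. -/
def kernel (t : ℕ → ℝ) : ℕ → ℕ → ℝ
  | 1, 0 => 1 / step t 1
  | 2, 0 => (1 + 2 * ratio t 2) / (step t 2 * (1 + ratio t 2))
  | 2, 1 => -(ratio t 2 ^ 2) / (step t 2 * (1 + ratio t 2))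
  | n + 3, j => kernel3 (step t (n + 3)) (ratio t (n + 3)) (ratio t (n + 2)) j
  | _, _ => 0

/-- The discrete derivative `D₃ v^n = ∑_{k=1}^n b_{n-k}^{(n)} (v^k - v^{k-1})`. -/
def discreteDeriv (t : ℕ → ℝ) (v : ℕ → ℝ) (n : ℕ) : ℝ :=
  ∑ k ∈ Finset.Icc 1 n, kernel t n (n - k) * (v k - v (k - 1))

/-- The lower triangular `N × N` matrix `B` of the kernels (its rows and columns
`1, …, N` are indexed by `0, …, N - 1`). -/
def kernelMatrix (t : ℕ → ℝ) (N : ℕ) : Matrix (Fin N) (Fin N) ℝ :=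
  Matrix.of fun i j => if j ≤ i then kernel t (i.val + 1) (i.val - j.val) else 0

/-- `Λ = diag (τ_1, …, τ_N)`. -/
def stepMatrix (t : ℕ → ℝ) (N : ℕ) : Matrix (Fin N) (Fin N) ℝ :=
  Matrix.diagonal fun i => step t (i.val + 1)

/-- `P > Q` for real, not necessarily symmetric, square matrices: `xᵀ (P - Q) x > 0`
for all `x ≠ 0`. -/
def MatrixGT {N : ℕ} (P Q : Matrix (Fin N) (Fin N) ℝ) : Prop :=
  ∀ x : Fin N → ℝ, x ≠ 0 → 0 < x ⬝ᵥ ((P - Q) *ᵥ x)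

/-- The constant `γ = 1/200`. -/
def γ : ℝ := 1 / 200

/-! ### The Allen-Cahn equation on a periodic box -/

/-- `w` has period `ℓ i` in the direction of the `i`-th coordinate, for every `i`. -/
def IsPeriodic {d : ℕ} (ℓ : Fin d → ℝ) (w : EuclideanSpace ℝ (Fin d) → ℝ) : Prop :=
  ∀ i x, w (x + EuclideanSpace.single i (ℓ i)) = w x

/-- The box `Ω = ∏ (0, ℓ i)`. -/
def box {d : ℕ} (ℓ : Fin d → ℝ) : Set (EuclideanSpace ℝ (Fin d)) :=
  {x | ∀ i, x i ∈ Set.Ioo 0 (ℓ i)}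

/-- The norm of `L²(Ω)`. -/
def normL2 {d : ℕ} (ℓ : Fin d → ℝ) (w : EuclideanSpace ℝ (Fin d) → ℝ) : ℝ :=
  Real.sqrt (∫ x in box ℓ, w x ^ 2)

/-- The bulk force `f(u) = u³ - u`. -/
def force (s : ℝ) : ℝ := s ^ 3 - s

/-- The time derivative `∂_t^k u (s, x)` on `[0, T]`, one-sided at the end points. -/
def timeDeriv {d : ℕ} (T : ℝ) (u : ℝ → EuclideanSpace ℝ (Fin d) → ℝ) (k : ℕ)
    (s : ℝ) (x : EuclideanSpace ℝ (Fin d)) : ℝ :=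
  iteratedDerivWithin k (fun s' => u s' x) (Set.Icc 0 T) s

/-- `u` is a classical solution on `[0, T]` of
`∂_t u - ε² Δ u + f(u) = 0`, `u(0) = u₀`, with periodic boundary conditions on the box,
of class `C²` in space and four times continuously differentiable in time. -/
structure IsSolution {d : ℕ} (ℓ : Fin d → ℝ) (ε T : ℝ) (u₀ : EuclideanSpace ℝ (Fin d) → ℝ)
    (u : ℝ → EuclideanSpace ℝ (Fin d) → ℝ) : Prop where
  periodic : ∀ s ∈ Set.Icc 0 T, IsPeriodic ℓ (u s)
  space_smooth : ∀ s ∈ Set.Icc 0 T, ContDiff ℝ 2 (u s)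
  time_smooth : ∀ x, ContDiffOn ℝ 4 (fun s => u s x) (Set.Icc 0 T)
  timeDeriv_continuous : ∀ k ≤ 4,
    ContinuousOn (fun p : ℝ × EuclideanSpace ℝ (Fin d) => timeDeriv T u k p.1 p.2)
      (Set.Icc 0 T ×ˢ Set.univ)
  initial : u 0 = u₀
  equation : ∀ s ∈ Set.Ioc 0 T, ∀ x,
    timeDeriv T u 1 s x - ε ^ 2 * Laplacian.laplacian (u s) x + force (u s x) = 0

/-- `v 0, …, v N` solves the time-discrete scheme
`D₃ v^n - ε² Δ v^n + f(v^n) = 0`, `1 ≤ n ≤ N`, `v^0 = u₀`, with periodic boundary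
conditions on the box. -/
structure IsDiscreteSolution {d : ℕ} (ℓ : Fin d → ℝ) (ε : ℝ)
    (u₀ : EuclideanSpace ℝ (Fin d) → ℝ) (N : ℕ) (t : ℕ → ℝ)
    (v : ℕ → EuclideanSpace ℝ (Fin d) → ℝ) : Prop where
  periodic : ∀ n ≤ N, IsPeriodic ℓ (v n)
  space_smooth : ∀ n ≤ N, ContDiff ℝ 2 (v n)
  initial : v 0 = u₀
  equation : ∀ n, 1 ≤ n → n ≤ N → ∀ x,
    discreteDeriv t (fun k => v k x) n - ε ^ 2 * Laplacian.laplacian (v n) x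
      + force (v n x) = 0

/-! ### The quantities in the error bound -/

/-- `∫_{t_{j-1}}^{t_j} ‖∂_t^k u‖ dt`, for `j ≥ 1`. -/
def derivMass {d : ℕ} (ℓ : Fin d → ℝ) (T : ℝ) (t : ℕ → ℝ)
    (u : ℝ → EuclideanSpace ℝ (Fin d) → ℝ) (k j : ℕ) : ℝ :=
  ∫ s in (t (j - 1))..(t j), normL2 ℓ (timeDeriv T u k s)

/-- The contribution of the first step and, for `n ≥ 2`, of the second step. -/
def startTerms {d : ℕ} (ℓ : Fin d → ℝ) (T : ℝ) (t : ℕ → ℝ)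
    (u : ℝ → EuclideanSpace ℝ (Fin d) → ℝ) (n : ℕ) : ℝ :=
  step t 1 ^ (1 / 2 : ℝ) * derivMass ℓ T t u 2 1
    + if 2 ≤ n then
        step t 2 ^ (3 / 2 : ℝ) * derivMass ℓ T t u 3 2
          + step t 1 * step t 2 ^ (1 / 2 : ℝ) * derivMass ℓ T t u 3 1
      else 0

/-- The contribution of the steps `3, …, n`. -/
def mainTerm {d : ℕ} (ℓ : Fin d → ℝ) (T : ℝ) (t : ℕ → ℝ)
    (u : ℝ → EuclideanSpace ℝ (Fin d) → ℝ) (n : ℕ) : ℝ :=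
  Real.sqrt (∑ k ∈ Finset.Icc 3 n, step t k *
    (step t k ^ 2 * derivMass ℓ T t u 4 k
      + step t (k - 1) ^ 2 * derivMass ℓ T t u 4 (k - 1)
      + step t (k - 2) ^ 2 * derivMass ℓ T t u 4 (k - 2)) ^ 2)

end BDF3

end

/-! Part (i) is a discrete dissipation argument. For entries x, y, z of a vector at levels n, n-1,
n-2 and the nonnegative form S_r(x, y) = `storage r x y`, every step satisfies x (b_0 x + b_1 y +
b_2 z) ≥ x²/(100 τ_n) + S_{r_n}(x, y)/τ_n - S_{r_{n-1}}(y, z)/τ_{n-1} (`local_dissipation`).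
Summation telescopes and leaves xᵀBx ≥ (1/100) ∑ x_n²/τ_n, twice what γ asks for. The local
inequality says that a form in three variables is nonnegative. Its Schur complement is a polynomial
in (r_n, r_{n-1}) of degrees 10 and 4 whose Bernstein coefficients on [0, 1.405]² are all positive
(`schur_eq_bernstein`).

Part (ii) combines consistency and stability. Consistency needs bounded step ratios, which are not
assumed: the 2 × 2 principal minors of the symmetric part of B force r_k ≤ 40 (`MatrixGT.ratio_le`).
Taylor expansion and Minkowski's integral inequality then bound the truncation errors in L².

For stability, the error e^n = u(t_n) - u^n is tested with its increment e^n - e^{n-1}, because B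
acts on increments: definiteness yields γ ∑ |e^n - e^{n-1}|²/τ_n, which absorbs the truncation error
and the linear terms by Young's inequality. The Dirichlet form telescopes by convexity. The cubic
term needs no bound on u^n: with w = u(t_n), the function w³ - (w - e)³ is the e-derivative of the
convex potential `relPotential w e`, so this term telescopes too, up to the drift of w over one
step, which costs a factor O(τ_n) times the energy itself. A discrete Grönwall inequality for
`errorEnergy` concludes (`normL2_error_sq_le`).

The constants involve only bounds of u and ∂_t u. These depend on u₀ alone because classical
solutions with the same data agree on the box (`IsSolution.eq_on_box`). -/

noncomputable section

namespace BDF3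

/-! ### Positive definiteness of the kernels under the step-ratio condition -/

/-- The Schur complement of the local quadratic form of `local_dissipation` (cleared of
denominators), in Bernstein form on the square `[0, 281/200]²`. -/
theorem schur_eq_bernstein (x a y b : ℝ) (ha : a = 1 - x) (hb : b = 1 - y) (r q D M₁ M₂ : ℝ)
    (hr : r = 281 / 200 * x) (hq : q = 281 / 200 * y)
    (hD : D = (1 + r) * (1 + q) * (1 + q + r * q))
    (hM₁ : M₁ = r * ((1 + 2 * q + r * q) ^ 2 - q * (1 + q)) / 2 - 9 / 50 * r * D)
    (hM₂ : M₂ = r * q * (1 + r) ^ 2 / 2) :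
    ((1 + q) * (1 + 2 * r + q * (1 + 4 * r + 3 * r ^ 2)) - (1 / 100 + 22 / 25) * D) * D *
        ((22 / 25 - 4 / 25 * r ^ 3) * (4 / 25) - (9 / 50) ^ 2) -
      r * (4 / 25 * M₁ ^ 2 - 2 * (9 / 50) * M₁ * M₂ + (22 / 25 - 4 / 25 * r ^ 3) * M₂ ^ 2) =
      a ^ 10 * ((4769600000000 * b ^ 4 + 45883552000000 * y * b ^ 3 +
        165524913840000 * y ^ 2 * b ^ 2 + 265391611856800 * y ^ 3 * b +
        159566706628901 * y ^ 4) / 400000000000000) +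
      x * a ^ 9 * ((6100968800000000 * b ^ 4 + 63912537020000000 * y * b ^ 3 +
        249400018218780000 * y ^ 2 * b ^ 2 + 430071013151115700 * y ^ 3 * b +
        276737736584570131 * y ^ 4) / 20000000000000000) +
      x ^ 2 * a ^ 8 * ((19571028352800000000 * b ^ 4 + 217748689925472000000 * y * b ^ 3 +
        895611898355080380000 * y ^ 2 * b ^ 2 + 1618479064470486745800 * y ^ 3 * b +
        1086463456927533203883 * y ^ 4) / 8000000000000000000) +
      x ^ 3 * a ^ 7 * ((7973530571520000000000 * b ^ 4 + 93875209738121404000000 * y * b ^ 3 +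
        403903525066215861480000 * y ^ 2 * b ^ 2 + 759727410364328909065500 * y ^ 3 * b +
        527034770953817090217091 * y ^ 4) / 800000000000000000000) +
      x ^ 4 * a ^ 6 * ((15577563846292480000000000 * b ^ 4 +
        194004427531160552800000000 * y * b ^ 3 + 866251746837361492022440000 * y ^ 2 * b ^ 2 +
        1689853232449213346677376400 * y ^ 3 * b +
        1200690712453237627324811021 * y ^ 4) / 640000000000000000000000) +
      x ^ 5 * a ^ 5 * ((12197269646759966400000000 * b ^ 4 +
        160918859146993288812000000 * y * b ^ 3 + 736023641911988933983620000 * y ^ 2 * b ^ 2 +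
        1488656392839794233493100700 * y ^ 3 * b +
        1072881591343933228205316503 * y ^ 4) / 320000000000000000000000) +
      x ^ 6 * a ^ 4 * ((624171415042311600000000000 * b ^ 4 +
        8741196550572980054503500000 * y * b ^ 3 + 39923564123047911751442382500 * y ^ 2 * b ^ 2 +
        84225927513576015433271202425 * y ^ 3 * b +
        60901037757925433955075506148 * y ^ 4) / 16000000000000000000000000) +
      x ^ 7 * a ^ 3 * ((82045102405020640000000000000 * b ^ 4 +
        1221619082239886682402800000000 * y * b ^ 3 +
        5273492578617460532006013352500 * y ^ 2 * b ^ 2 +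
        11843371829603082733205775844000 * y ^ 3 * b +
        8464577582752846156962004524009 * y ^ 4) / 3200000000000000000000000000) +
      x ^ 8 * a ^ 2 * ((32544860112668640000000000000 * b ^ 4 +
        515325661246482939004200000000 * y * b ^ 3 +
        1842702961249376436253462065000 * y ^ 2 * b ^ 2 +
        4703496356252012342675286637000 * y ^ 3 * b +
        3210959544736204322239554926927 * y ^ 4) / 3200000000000000000000000000) +
      x ^ 9 * a * ((6719585749300720000000000000 * b ^ 4 +
        112867750762153105802800000000 * y * b ^ 3 +
        222478151476573343321009949525 * y ^ 2 * b ^ 2 +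
        872217186389772501994504436050 * y ^ 3 * b +
        481193842380548274465078557252 * y ^ 4) / 3200000000000000000000000000) +
      x ^ 10 * ((15172205513205248000000000000 * b ^ 4 +
        267155710226808909462400000000 * y * b ^ 3 +
        33785070633754933927175002561 * y ^ 2 * b ^ 2 +
        2481894002560768507813027893122 * y ^ 3 * b +
        131068639745098724250890609249 * y ^ 4) / 102400000000000000000000000000) := by
  subst hM₁ hM₂ hD hr hq ha hb
  ring

theorem schur_nonneg {r q D M₁ M₂ : ℝ} (hr0 : 0 ≤ r) (hr : r ≤ 281 / 200) (hq0 : 0 ≤ q)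
    (hq : q ≤ 281 / 200)
    (hD : D = (1 + r) * (1 + q) * (1 + q + r * q))
    (hM₁ : M₁ = r * ((1 + 2 * q + r * q) ^ 2 - q * (1 + q)) / 2 - 9 / 50 * r * D)
    (hM₂ : M₂ = r * q * (1 + r) ^ 2 / 2) :
    r * (4 / 25 * M₁ ^ 2 - 2 * (9 / 50) * M₁ * M₂ + (22 / 25 - 4 / 25 * r ^ 3) * M₂ ^ 2) ≤
    ((1 + q) * (1 + 2 * r + q * (1 + 4 * r + 3 * r ^ 2)) - (1 / 100 + 22 / 25) * D) * D *
        ((22 / 25 - 4 / 25 * r ^ 3) * (4 / 25) - (9 / 50) ^ 2) := by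
  have h := schur_eq_bernstein (200 / 281 * r) _ (200 / 281 * q) _ rfl rfl r q D M₁ M₂
    (by ring) (by ring) hD hM₁ hM₂
  rw [← sub_nonneg, h]
  have hx : 0 ≤ 200 / 281 * r := by positivity
  have hy : 0 ≤ 200 / 281 * q := by positivity
  have ha : 0 ≤ 1 - 200 / 281 * r := by linarith
  have hb : 0 ≤ 1 - 200 / 281 * q := by linarith
  -- With x, y, a, b unrelated nonnegative variables, positivity of the Bernstein coefficients is
  -- all that remains to be seen.
  generalize 1 - 200 / 281 * r = a at ha ⊢
  generalize 1 - 200 / 281 * q = b at hb ⊢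
  generalize 200 / 281 * r = x at hx ⊢
  generalize 200 / 281 * q = y at hy ⊢
  positivity

/-- A quadratic form in `(x, y, z)` whose `(y, z)` block is positive definite is nonnegative when
its Schur complement is. -/
theorem quadForm_nonneg_of_schur {N D r m b c M₁ M₂ : ℝ} (hD : 0 < D) (hr : 0 ≤ r) (hc : 0 < c)
    (hΔ : 0 < m * c - b ^ 2)
    (h : r * (c * M₁ ^ 2 - 2 * b * M₁ * M₂ + m * M₂ ^ 2) ≤ N * D * (m * c - b ^ 2))
    (x y z : ℝ) :
    0 ≤ N * x ^ 2 - 2 * r * M₁ * (x * y) + 2 * r * M₂ * (x * z) +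
      r * D * (m * y ^ 2 - 2 * b * (y * z) + c * z ^ 2) := by
  -- Completing the square first in z, then in y, leaves x² times the Schur complement.
  have key : c * D * (m * c - b ^ 2) * (N * x ^ 2 - 2 * r * M₁ * (x * y) + 2 * r * M₂ * (x * z) +
      r * D * (m * y ^ 2 - 2 * b * (y * z) + c * z ^ 2)) =
      c * x ^ 2 * (N * D * (m * c - b ^ 2) -
        r * (c * M₁ ^ 2 - 2 * b * M₁ * M₂ + m * M₂ ^ 2)) +
      r * (((c * M₁ - b * M₂) * x - (m * c - b ^ 2) * D * y) ^ 2 +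
        (m * c - b ^ 2) * (M₂ * x + D * (c * z - b * y)) ^ 2) := by ring
  have h0 : 0 ≤ N * D * (m * c - b ^ 2) -
        r * (c * M₁ ^ 2 - 2 * b * M₁ * M₂ + m * M₂ ^ 2) := sub_nonneg.2 h
  refine nonneg_of_mul_nonneg_right (a := c * D * (m * c - b ^ 2)) ?_ (by positivity)
  rw [key]
  positivity

/-- The quadratic storage function of the discrete gradient structure. -/
def storage (r x y : ℝ) : ℝ := 22 / 25 * x ^ 2 - 2 * (9 / 50) * r ^ 2 * (x * y) + 4 / 25 * r ^ 4 * y ^ 2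

theorem storage_nonneg (r x y : ℝ) : 0 ≤ storage r x y := by
  unfold storage
  nlinarith [sq_nonneg (2 / 5 * r ^ 2 * y - 9 / 20 * x), sq_nonneg x]

/-- Multiplied by s D, with `den s r q` = s D, the difference of the two sides is the form of
`quadForm_nonneg_of_schur`. The weights 22/25, 9/50, 4/25 of the storage and the rate 1/100 are
numerical choices for which the Schur complement stays nonnegative up to the ratio 281/200 = 1.405.
-/
theorem local_dissipation {s r q : ℝ} (hs : 0 < s) (hr0 : 0 ≤ r) (hr : r ≤ 281 / 200)
    (hq0 : 0 ≤ q) (hq : q ≤ 281 / 200) (x y z : ℝ) :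
    1 / 100 / s * x ^ 2 + storage r x y / s - r * storage q y z / s ≤
      x * (kernel3 s r q 0 * x + kernel3 s r q 1 * y + kernel3 s r q 2 * z) := by
  obtain ⟨D, hD⟩ : ∃ D, D = (1 + r) * (1 + q) * (1 + q + r * q) := ⟨_, rfl⟩
  have hDpos : 0 < D := by rw [hD]; positivity
  have hr3 : r ^ 3 ≤ (281 / 200) ^ 3 := by gcongr
  -- The third variable is q² z: z enters the storage only in this combination, and the factor q³ of
  -- b_2 contains it.
  have h := quadForm_nonneg_of_schur hDpos hr0 (by norm_num : (0 : ℝ) < 4 / 25)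
    (by nlinarith) (schur_nonneg hr0 hr hq0 hq hD rfl rfl) x y (q ^ 2 * z)
  have hden : den s r q = s * D := by rw [hD, den]; ring
  simp only [kernel3, hden]
  rw [← sub_nonneg]
  refine (div_nonneg h (by positivity : 0 ≤ s * D)).trans_eq ?_
  unfold storage
  field_simp
  rw [hD]
  ring

theorem IsGrid.step_pos {T : ℝ} {N : ℕ} {t : ℕ → ℝ} (h : IsGrid T N t) {k : ℕ} (hk1 : 1 ≤ k)
    (hkN : k ≤ N) : 0 < step t k := by
  obtain ⟨k, rfl⟩ := Nat.exists_eq_add_of_le' hk1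
  exact sub_pos.2 (h.lt_succ k hkN)

theorem stepMatrix_inv {t : ℕ → ℝ} {N : ℕ} (h : ∀ k < N, 0 < step t (k + 1)) :
    (stepMatrix t N)⁻¹ = Matrix.diagonal fun i : Fin N => (step t (i.val + 1))⁻¹ := by
  refine Matrix.inv_eq_left_inv ?_
  rw [stepMatrix, Matrix.diagonal_mul_diagonal, ← Matrix.diagonal_one]
  congr 1
  funext i
  exact inv_mul_cancel₀ (h i i.2).ne'

/-- The quadratic form of `B - c Λ⁻¹` as a sum over the time levels. -/
theorem form_eq_sum {t : ℕ → ℝ} {N : ℕ} (h : ∀ k < N, 0 < step t (k + 1)) (c : ℝ) (X : ℕ → ℝ) :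
    (fun i : Fin N => X i) ⬝ᵥ ((kernelMatrix t N - c • (stepMatrix t N)⁻¹) *ᵥ fun i : Fin N => X i) =
      ∑ n ∈ Finset.range N, (X n * ∑ k ∈ Finset.range (n + 1), kernel t (n + 1) (n - k) * X k -
        c / step t (n + 1) * X n ^ 2) := by
  rw [stepMatrix_inv h, Matrix.sub_mulVec, Matrix.smul_mulVec, dotProduct,
    ← Fin.sum_univ_eq_sum_range (fun n => X n * ∑ k ∈ Finset.range (n + 1),
      kernel t (n + 1) (n - k) * X k - c / step t (n + 1) * X n ^ 2)]
  refine Finset.sum_congr rfl fun i _ => ?_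
  rw [Pi.sub_apply, Pi.smul_apply, Matrix.mulVec_diagonal, mul_sub]
  congr 1
  · congr 1
    simp only [Matrix.mulVec, dotProduct, kernelMatrix, Matrix.of_apply, ite_mul, zero_mul,
      Fin.le_def]
    rw [Fin.sum_univ_eq_sum_range (fun j => if j ≤ (i : ℕ) then
      kernel t (i + 1) (i - j) * X j else 0), ← Finset.sum_filter]
    refine Finset.sum_congr ?_ fun _ _ => rfl
    ext j
    simp only [Finset.mem_filter, Finset.mem_range]
    have := i.2
    omega
  · rw [smul_eq_mul]; ring

/-- The three-term form of the discrete operator. -/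
theorem sum_kernel_add_three (t : ℕ → ℝ) (n : ℕ) (X : ℕ → ℝ) :
    ∑ k ∈ Finset.range (n + 3), kernel t (n + 3) (n + 2 - k) * X k =
      kernel3 (step t (n + 3)) (ratio t (n + 3)) (ratio t (n + 2)) 0 * X (n + 2) +
      kernel3 (step t (n + 3)) (ratio t (n + 3)) (ratio t (n + 2)) 1 * X (n + 1) +
      kernel3 (step t (n + 3)) (ratio t (n + 3)) (ratio t (n + 2)) 2 * X n := by
  rw [Finset.sum_range_succ, Finset.sum_range_succ, Finset.sum_range_succ, Finset.sum_eq_zero]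
  · rw [show n + 2 - n = 2 by omega, show n + 2 - (n + 1) = 1 by omega,
      show n + 2 - (n + 2) = 0 by omega]
    simp only [kernel]
    ring
  · intro k hk
    obtain ⟨j, hj⟩ : ∃ j, n + 2 - k = j + 3 :=
      ⟨n + 2 - k - 3, by have := Finset.mem_range.1 hk; omega⟩
    rw [hj]
    simp only [kernel, kernel3, zero_mul]

/-- The stored energy after `n` steps. -/
def storedEnergy (t : ℕ → ℝ) (X : ℕ → ℝ) : ℕ → ℝ
  | 0 => 0
  | 1 => storage 0 (X 0) 0 / step t 1
  | n + 2 => storage (ratio t (n + 2)) (X (n + 1)) (X n) / step t (n + 2)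

theorem storedEnergy_nonneg {T : ℝ} {N : ℕ} {t : ℕ → ℝ} (h : IsGrid T N t) (X : ℕ → ℝ) {n : ℕ}
    (hn : n ≤ N) : 0 ≤ storedEnergy t X n := by
  match n with
  | 0 => exact le_rfl
  | 1 => exact div_nonneg (storage_nonneg _ _ _) (h.step_pos le_rfl hn).le
  | n + 2 => exact div_nonneg (storage_nonneg _ _ _) (h.step_pos (by omega) hn).le

/-- The factor r/s in `local_dissipation` is the reciprocal of the previous step, so its subtracted
term is exactly the energy stored one level earlier. BDF1 and BDF2 are `kernel3` at r = q = 0 and at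
q = 0, so the two starting steps are degenerate cases of the same inequality. -/
theorem storedEnergy_succ_sub_le {T : ℝ} {N : ℕ} {t : ℕ → ℝ} (h : IsGrid T N t)
    (hr : ∀ k, 2 ≤ k → k ≤ N → ratio t k ≤ 281 / 200) (X : ℕ → ℝ) {n : ℕ} (hn : n < N) :
    1 / 100 / step t (n + 1) * X n ^ 2 + storedEnergy t X (n + 1) - storedEnergy t X n ≤
      X n * ∑ k ∈ Finset.range (n + 1), kernel t (n + 1) (n - k) * X k := by
  have hr0 : ∀ k, 2 ≤ k → k ≤ N → 0 ≤ ratio t k := fun k h1 h2 =>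
    (div_pos (h.step_pos (by omega) h2) (h.step_pos (by omega) (by omega))).le
  have hs := h.step_pos (by omega : 1 ≤ n + 1) hn
  match n with
  | 0 =>
    have := local_dissipation hs le_rfl (by norm_num) le_rfl (by norm_num) (X 0) 0 0
    simpa [storedEnergy, kernel, kernel3, den] using this
  | 1 =>
    have hs1 := h.step_pos le_rfl (by omega : 1 ≤ N)
    have := local_dissipation hs (hr0 2 le_rfl hn) (hr 2 le_rfl hn) le_rfl (by norm_num)
      (X 1) (X 0) 0
    have e : storage 0 (X 0) 0 / step t 1 =
        ratio t 2 * storage 0 (X 0) 0 / step t 2 := by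
      rw [ratio]
      have : 0 < step t 2 := hs
      field_simp
    simp only [storedEnergy, e, zero_add, Finset.sum_range_succ, Finset.sum_range_zero]
    refine this.trans_eq ?_
    simp [kernel, kernel3, den]
    exact Or.inl (by ring)
  | n + 2 =>
    have hs1 := h.step_pos (by omega : 1 ≤ n + 2) (by omega)
    have := local_dissipation hs (hr0 _ (by omega) hn) (hr _ (by omega) hn)
      (hr0 (n + 2) (by omega) (by omega)) (hr _ (by omega) (by omega)) (X (n + 2)) (X (n + 1)) (X n)
    have e : storage (ratio t (n + 2)) (X (n + 1)) (X n) / step t (n + 2) =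
        ratio t (n + 3) * storage (ratio t (n + 2)) (X (n + 1)) (X n) / step t (n + 3) := by
      rw [show ratio t (n + 3) = step t (n + 3) / step t (n + 2) from rfl]
      have : 0 < step t (n + 3) := hs
      field_simp
    simp only [storedEnergy, e, sum_kernel_add_three]
    exact this

/-- Positive definiteness of the variable-step BDF3 kernels for step ratios at most `1.405`. -/
theorem kernelMatrix_gt {T : ℝ} {N : ℕ} {t : ℕ → ℝ} (h : IsGrid T N t)
    (hr : ∀ k, 2 ≤ k → k ≤ N → ratio t k ≤ 1.405) :
    MatrixGT (kernelMatrix t N) (γ • (stepMatrix t N)⁻¹) := by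
  have hr' : ∀ k, 2 ≤ k → k ≤ N → ratio t k ≤ 281 / 200 := fun k h1 h2 =>
    (hr k h1 h2).trans (by norm_num)
  have hpos : ∀ k < N, 0 < step t (k + 1) := fun k hk => h.step_pos (by omega) hk
  intro x hx
  obtain ⟨X, rfl⟩ : ∃ X : ℕ → ℝ, x = fun i : Fin N => X i :=
    ⟨fun k => if hk : k < N then x ⟨k, hk⟩ else 0, by funext i; simp⟩
  rw [form_eq_sum hpos]
  -- The stored energies telescope to a nonnegative quantity; the surplus 1/100 - γ makes the
  -- inequality strict.
  have h1 : ∑ n ∈ Finset.range N, (storedEnergy t X (n + 1) - storedEnergy t X n) +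
      ∑ n ∈ Finset.range N, (1 / 100 - γ) / step t (n + 1) * X n ^ 2 ≤
      ∑ n ∈ Finset.range N, (X n * ∑ k ∈ Finset.range (n + 1), kernel t (n + 1) (n - k) * X k -
        γ / step t (n + 1) * X n ^ 2) := by
    rw [← Finset.sum_add_distrib]
    refine Finset.sum_le_sum fun n hn => ?_
    have := storedEnergy_succ_sub_le h hr' X (Finset.mem_range.1 hn)
    rw [sub_div, sub_mul]
    linarith
  refine lt_of_lt_of_le ?_ h1
  rw [Finset.sum_range_sub, storedEnergy, sub_zero]
  refine add_pos_of_nonneg_of_pos (storedEnergy_nonneg h X le_rfl) ?_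
  obtain ⟨i, hi⟩ := Function.ne_iff.1 hx
  have hγ : 0 < 1 / 100 - γ := by norm_num [γ]
  refine Finset.sum_pos' (fun n hn => ?_) ⟨i, Finset.mem_range.2 i.2, ?_⟩
  · have := hpos n (Finset.mem_range.1 hn)
    positivity
  · have := hpos i i.2
    have hi' : X i ≠ 0 := hi
    positivity

/-- Positive definiteness of `B - c Λ⁻¹`, applied to a sequence supported on the first `n` steps. -/
theorem MatrixGT.sum_le {t : ℕ → ℝ} {N : ℕ} (h : ∀ k < N, 0 < step t (k + 1)) {c : ℝ}
    (hB : MatrixGT (kernelMatrix t N) (c • (stepMatrix t N)⁻¹)) (X : ℕ → ℝ) {n : ℕ} (hn : n ≤ N) :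
    ∑ m ∈ Finset.range n, c / step t (m + 1) * X m ^ 2 ≤
      ∑ m ∈ Finset.range n, X m * ∑ k ∈ Finset.range (m + 1), kernel t (m + 1) (m - k) * X k := by
  set Y : ℕ → ℝ := fun k => if k < n then X k else 0 with hY
  have h0 : 0 ≤ (fun i : Fin N => Y i) ⬝ᵥ
      ((kernelMatrix t N - c • (stepMatrix t N)⁻¹) *ᵥ fun i : Fin N => Y i) := by
    by_cases hz : (fun i : Fin N => Y i) = 0
    · rw [hz]; simp
    · exact (hB _ hz).le
  rw [form_eq_sum h, ← Finset.sum_subset (Finset.range_mono hn)] at h0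
  · rw [← sub_nonneg, ← Finset.sum_sub_distrib]
    refine h0.trans_eq (Finset.sum_congr rfl fun m hm => ?_)
    have hm' := Finset.mem_range.1 hm
    have e : Y m = X m := if_pos hm'
    rw [e]
    congr 2
    refine Finset.sum_congr rfl fun k hk => ?_
    rw [hY]
    simp only
    rw [if_pos (by have := Finset.mem_range.1 hk; omega)]
  · intro m _ hm
    have : Y m = 0 := if_neg (by simpa using hm)
    rw [this]; ring

/-- The discrete derivative in terms of the increments. -/
theorem discreteDeriv_succ (t v : ℕ → ℝ) (n : ℕ) :
    discreteDeriv t v (n + 1) =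
      ∑ k ∈ Finset.range (n + 1), kernel t (n + 1) (n - k) * (v (k + 1) - v k) := by
  have h := Finset.sum_Ico_add' (fun k => kernel t (n + 1) (n + 1 - k) * (v k - v (k - 1))) 0 (n + 1) 1
  rw [discreteDeriv, Finset.range_eq_Ico]
  refine Eq.trans ?_ (h.symm.trans ?_)
  · rfl
  refine Finset.sum_congr rfl fun k _ => ?_
  rw [Nat.add_sub_add_right, Nat.add_sub_cancel]

theorem discreteDeriv_sub (t v w : ℕ → ℝ) (n : ℕ) :
    discreteDeriv t (fun k => v k - w k) n = discreteDeriv t v n - discreteDeriv t w n := by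
  rw [discreteDeriv, discreteDeriv, discreteDeriv, ← Finset.sum_sub_distrib]
  exact Finset.sum_congr rfl fun k _ => by ring

/-! ### Bounds of the kernels and of the step ratios -/

theorem den_pos {s r q : ℝ} (hs : 0 < s) (hr : 0 ≤ r) (hq : 0 ≤ q) : 0 < den s r q := by
  unfold den; positivity

theorem kernel3_zero_nonneg {s r q : ℝ} (hs : 0 < s) (hr : 0 ≤ r) (hq : 0 ≤ q) :
    0 ≤ kernel3 s r q 0 :=
  div_nonneg (by positivity) (den_pos hs hr hq).le

theorem kernel3_zero_le {s r q : ℝ} (hs : 0 < s) (hr : 0 ≤ r) (hq : 0 ≤ q) :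
    kernel3 s r q 0 ≤ 3 / s := by
  have hd := den_pos hs hr hq
  rw [kernel3, div_le_div_iff₀ hd hs, ← sub_nonneg]
  have : 3 * den s r q -
      (1 + q) * (1 + 2 * r + q * (1 + 4 * r + 3 * r ^ 2)) * s =
      s * (1 + q) * (2 + r + 2 * q + 2 * q * r) := by
    rw [den]; ring
  rw [this]
  positivity

/-- The lower bound is the value at q = 0, that is, the BDF2 coefficient. Its growth in r is what
excludes large ratios in `MatrixGT.ratio_le`. -/
theorem le_neg_kernel3_one {s r q : ℝ} (hs : 0 < s) (hr : 0 ≤ r) (hq : 0 ≤ q) :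
    r ^ 2 / (s * (1 + r)) ≤ -kernel3 s r q 1 := by
  have hd := den_pos hs hr hq
  rw [kernel3, neg_div, neg_neg, div_le_div_iff₀ (by positivity) hd, ← sub_nonneg]
  have : r ^ 2 * ((1 + 2 * q + r * q) ^ 2 - q * (1 + q)) * (s * (1 + r)) - r ^ 2 * den s r q =
      r ^ 2 * s * (1 + r) * (q + 2 * q ^ 2 + r * q + 3 * r * q ^ 2 + r ^ 2 * q ^ 2) := by
    rw [den]; ring
  rw [this]
  positivity

theorem neg_kernel3_one_le {s r q : ℝ} (hs : 0 < s) (hr : 0 ≤ r) (hq : 0 ≤ q) :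
    -kernel3 s r q 1 ≤ 4 * r ^ 2 / s := by
  have hd := den_pos hs hr hq
  rw [kernel3, neg_div, neg_neg, div_le_div_iff₀ hd hs, ← sub_nonneg]
  have : 4 * r ^ 2 * den s r q - r ^ 2 * ((1 + 2 * q + r * q) ^ 2 - q * (1 + q)) * s =
      r ^ 2 * s * (3 + 5 * q + 4 * r + q ^ 2 + 10 * q * r + 8 * q ^ 2 * r - 4 * q ^ 2 * r +
        4 * q * r ^ 2 + 3 * q ^ 2 * r ^ 2) := by
    rw [den]; ring
  rw [this]
  have : 0 ≤ 3 + 5 * q + 4 * r + q ^ 2 + 10 * q * r + 8 * q ^ 2 * r - 4 * q ^ 2 * r +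
        4 * q * r ^ 2 + 3 * q ^ 2 * r ^ 2 := by
    have : 0 ≤ q ^ 2 * r := by positivity
    have : 0 ≤ 3 + 5 * q + 4 * r + q ^ 2 + 10 * q * r + 4 * q * r ^ 2 + 3 * q ^ 2 * r ^ 2 := by
      positivity
    linarith
  positivity

theorem kernel3_two_nonneg {s r q : ℝ} (hs : 0 < s) (hr : 0 ≤ r) (hq : 0 ≤ q) :
    0 ≤ kernel3 s r q 2 :=
  div_nonneg (by positivity) (den_pos hs hr hq).le

theorem kernel3_two_le {s r q : ℝ} (hs : 0 < s) (hr : 0 ≤ r) (hq : 0 ≤ q) :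
    kernel3 s r q 2 ≤ r ^ 2 * q ^ 3 * (1 + r) / s := by
  have hd := den_pos hs hr hq
  rw [kernel3, div_le_div_iff₀ hd hs, ← sub_nonneg]
  have : r ^ 2 * q ^ 3 * (1 + r) * den s r q - r ^ 2 * q ^ 3 * (1 + r) ^ 2 * s =
      r ^ 2 * q ^ 3 * (1 + r) ^ 2 * s * (q * (2 + q + r + r * q)) := by
    rw [den]; ring
  rw [this]
  positivity

theorem kernel_zero_bounds {T : ℝ} {N : ℕ} {t : ℕ → ℝ} (h : IsGrid T N t) {n : ℕ} (h1 : 1 ≤ n)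
    (hn : n ≤ N) : 0 ≤ kernel t n 0 ∧ kernel t n 0 ≤ 3 / step t n := by
  have hs := h.step_pos h1 hn
  have hr0 : ∀ k, 2 ≤ k → k ≤ N → 0 ≤ ratio t k := fun k h1 h2 =>
    (div_pos (h.step_pos (by omega) h2) (h.step_pos (by omega) (by omega))).le
  match n with
  | 1 =>
    simp only [kernel]
    refine ⟨by positivity, ?_⟩
    gcongr
    norm_num
  | 2 =>
    have e : kernel t 2 0 = kernel3 (step t 2) (ratio t 2) 0 0 := by simp [kernel, kernel3, den]
    rw [e]
    exact ⟨kernel3_zero_nonneg hs (hr0 2 le_rfl hn) le_rfl,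
      kernel3_zero_le hs (hr0 2 le_rfl hn) le_rfl⟩
  | n + 3 =>
    have h2 := hr0 (n + 2) (by omega) (by omega)
    have h3 := hr0 (n + 3) (by omega) hn
    exact ⟨kernel3_zero_nonneg hs h3 h2, kernel3_zero_le hs h3 h2⟩

theorem le_neg_kernel_one {T : ℝ} {N : ℕ} {t : ℕ → ℝ} (h : IsGrid T N t) {n : ℕ} (h1 : 2 ≤ n)
    (hn : n ≤ N) : ratio t n ^ 2 / (step t n * (1 + ratio t n)) ≤ -kernel t n 1 := by
  have hs := h.step_pos (by omega : 1 ≤ n) hn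
  have hr0 : ∀ k, 2 ≤ k → k ≤ N → 0 ≤ ratio t k := fun k h1 h2 =>
    (div_pos (h.step_pos (by omega) h2) (h.step_pos (by omega) (by omega))).le
  match n with
  | 2 => simp only [kernel, neg_div, neg_neg]; exact le_rfl
  | n + 3 => exact le_neg_kernel3_one hs (hr0 (n + 3) (by omega) hn) (hr0 (n + 2) (by omega) (by omega))

/-- The `2 × 2` principal minors of the symmetric part of `B` are nonnegative. -/
theorem MatrixGT.kernel_one_sq_le {T : ℝ} {N : ℕ} {t : ℕ → ℝ} (h : IsGrid T N t) {c : ℝ}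
    (hc : 0 ≤ c) (hB : MatrixGT (kernelMatrix t N) (c • (stepMatrix t N)⁻¹)) {j : ℕ}
    (hj : j + 2 ≤ N) :
    kernel t (j + 2) 1 ^ 2 ≤ 4 * kernel t (j + 2) 0 * kernel t (j + 1) 0 := by
  have hpos : ∀ k < N, 0 < step t (k + 1) := fun k hk => h.step_pos (by omega) hk
  have key : ∀ x : ℝ, 0 ≤ kernel t (j + 2) 0 * (x * x) + kernel t (j + 2) 1 * x +
      kernel t (j + 1) 0 := by
    intro x
    -- On vectors supported on two consecutive levels the form is a quadratic polynomial in x, and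
    -- nonnegativity bounds its discriminant.
    set X : ℕ → ℝ := fun k => if k = j then 1 else if k = j + 1 then x else 0 with hX
    have hXj : X j = 1 := by simp [hX]
    have hXj1 : X (j + 1) = x := by simp [hX]
    have hX0 : ∀ k < j, X k = 0 := fun k hk => by
      simp only [hX]
      rw [if_neg (by omega), if_neg (by omega)]
    have h1 := hB.sum_le hpos X hj
    have h0 : 0 ≤ ∑ m ∈ Finset.range (j + 2), c / step t (m + 1) * X m ^ 2 :=
      Finset.sum_nonneg fun m hm => by
        have := hpos m (by have := Finset.mem_range.1 hm; omega)
        positivity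
    refine (h0.trans h1).trans_eq ?_
    rw [Finset.sum_range_succ, Finset.sum_range_succ, Finset.sum_eq_zero fun m hm => by
      rw [hX0 m (Finset.mem_range.1 hm), zero_mul], Finset.sum_range_succ _ (j + 1),
      Finset.sum_range_succ _ j, Finset.sum_eq_zero fun m hm => by
      rw [hX0 m (Finset.mem_range.1 hm), mul_zero], Finset.sum_range_succ _ j,
      Finset.sum_eq_zero fun m hm => by
      rw [hX0 m (Finset.mem_range.1 hm), mul_zero], hXj, hXj1,
      Nat.sub_self, Nat.sub_self, Nat.add_sub_cancel_left]
    ring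
  have := discrim_le_zero key
  rw [discrim] at this
  linarith

/-- Inserting b_0 ≤ 3/τ and |b_1| ≥ r²/(τ (1 + r)) into the minor inequality gives r³ ≤ 36 (1 + r)²,
which fails for r > 40. This supplies the ratio bound that consistency needs when only definiteness
of B is known. -/
theorem MatrixGT.ratio_le {T : ℝ} {N : ℕ} {t : ℕ → ℝ} (h : IsGrid T N t) {c : ℝ}
    (hc : 0 ≤ c) (hB : MatrixGT (kernelMatrix t N) (c • (stepMatrix t N)⁻¹)) {n : ℕ}
    (hn2 : 2 ≤ n) (hn : n ≤ N) : ratio t n ≤ 40 := by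
  obtain ⟨j, rfl⟩ := Nat.exists_eq_add_of_le' hn2
  have h1 := hB.kernel_one_sq_le h hc hn
  have ⟨_, h2⟩ := kernel_zero_bounds h (by omega : 1 ≤ j + 2) hn
  have ⟨h3', h3⟩ := kernel_zero_bounds h (by omega : 1 ≤ j + 1) (by omega)
  have h4 := le_neg_kernel_one h hn2 hn
  have hs := h.step_pos (by omega : 1 ≤ j + 2) hn
  have hs1 := h.step_pos (by omega : 1 ≤ j + 1) (by omega)
  have hr : ratio t (j + 2) = step t (j + 2) / step t (j + 1) := rfl
  have hr0 : 0 < ratio t (j + 2) := by rw [hr]; positivity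
  have hm : step t (j + 1) = step t (j + 2) / ratio t (j + 2) := by rw [hr]; field_simp
  generalize ratio t (j + 2) = r at *
  rw [hm] at h3
  generalize step t (j + 2) = s at *
  have h5 : (r ^ 2 / (s * (1 + r))) ^ 2 ≤ kernel t (j + 2) 1 ^ 2 := by
    rw [← neg_sq (kernel t (j + 2) 1)]
    exact pow_le_pow_left₀ (by positivity) h4 2
  have h6 : 4 * kernel t (j + 2) 0 * kernel t (j + 1) 0 ≤ 4 * (3 / s) * (3 / (s / r)) := by
    gcongr
  have h7 := h5.trans (h1.trans h6)
  have h8 : r ^ 3 ≤ 36 * (1 + r) ^ 2 := by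
    have e1 : (r ^ 2 / (s * (1 + r))) ^ 2 = r ^ 3 * (r / (s ^ 2 * (1 + r) ^ 2)) := by field_simp
    have e2 : 4 * (3 / s) * (3 / (s / r)) = 36 * (1 + r) ^ 2 * (r / (s ^ 2 * (1 + r) ^ 2)) := by
      field_simp; norm_num
    rw [e1, e2] at h7
    exact le_of_mul_le_mul_right h7 (by positivity)
  by_contra! hcon
  nlinarith [mul_pos (sub_pos.2 hcon) (sub_pos.2 hcon), mul_pos hr0 (mul_pos (sub_pos.2 hcon) (sub_pos.2 hcon))]

/-! ### Taylor remainders and truncation errors -/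

/-- Taylor's formula with a remainder bound by the integral of the modulus of the top
derivative. -/
theorem abs_sub_taylor_le {a b : ℝ} (hab : a ≤ b) {c : ℝ} (hc : c ∈ Set.Icc a b) (m : ℕ)
    (G : ℕ → ℝ → ℝ)
    (hG : ∀ k ≤ m, ∀ s ∈ Set.Icc a b, HasDerivWithinAt (G k) (G (k + 1) s) (Set.Icc a b) s)
    (hcont : ContinuousOn (G (m + 1)) (Set.Icc a b)) {s : ℝ} (hs : s ∈ Set.Icc a b) :
    |G 0 s - ∑ k ∈ Finset.range (m + 1), (s - c) ^ k / (k.factorial : ℝ) * G k c| ≤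
      (b - a) ^ m * ∫ x in a..b, |G (m + 1) x| := by
  have hint : IntervalIntegrable (fun x => |G (m + 1) x|) MeasureTheory.volume a b :=
    (continuous_abs.comp_continuousOn hcont).intervalIntegrable_of_Icc hab
  induction m generalizing G s with
  | zero =>
    simp only [zero_add, Finset.sum_range_one, pow_zero, Nat.factorial_zero, Nat.cast_one, div_one,
      one_mul]
    have main : ∀ x ∈ Set.Icc a b, ∀ y ∈ Set.Icc a b, x ≤ y →
        |G 0 y - G 0 x| ≤ ∫ z in a..b, |G 1 z| := by
      intro x hx y hy hxy
      have hsub : Set.Icc x y ⊆ Set.Icc a b := Set.Icc_subset_Icc hx.1 hy.2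
      rw [← intervalIntegral.integral_eq_sub_of_hasDerivAt_of_le hxy
        (fun z hz => ((hG 0 le_rfl z (hsub hz)).continuousWithinAt.mono hsub))
        (fun z hz => (hG 0 le_rfl z (hsub (Set.Ioo_subset_Icc_self hz))).hasDerivAt
          (Icc_mem_nhds (hx.1.trans_lt hz.1) (hz.2.trans_le hy.2)))
        ((hcont.mono hsub).intervalIntegrable_of_Icc hxy)]
      refine (intervalIntegral.abs_integral_le_integral_abs hxy).trans ?_
      exact intervalIntegral.integral_mono_interval hx.1 hxy hy.2
        (Filter.Eventually.of_forall fun z => abs_nonneg _) hint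
    rcases le_total c s with h | h
    · exact main c hc s hs h
    · rw [abs_sub_comm]; exact main s hs c hc h
  | succ m ih =>
    have ih' := fun z hz => ih (fun k => G (k + 1)) (fun k hk => hG (k + 1) (by omega)) hcont
      (s := z) hz hint
    -- The remainder of G 0 vanishes at c and its derivative is the lower-order remainder of G 1, so
    -- the mean value inequality contributes one more factor b - a.
    set H : ℝ → ℝ := fun z => G 0 z - ∑ k ∈ Finset.range (m + 2),
      (z - c) ^ k / (k.factorial : ℝ) * G k c with hH
    have hd : ∀ z ∈ Set.Icc a b, HasDerivWithinAt H (G 1 z - ∑ k ∈ Finset.range (m + 1),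
        (z - c) ^ k / (k.factorial : ℝ) * G (k + 1) c) (Set.Icc a b) z := by
      intro z hz
      refine (hG 0 (by omega) z hz).sub ?_
      have h1 : ∀ k ∈ Finset.range (m + 1), HasDerivAt
          (fun z => (z - c) ^ (k + 1) / ((k + 1).factorial : ℝ) * G (k + 1) c)
          ((z - c) ^ k / (k.factorial : ℝ) * G (k + 1) c) z := by
        intro k _
        have := ((((hasDerivAt_id z).sub_const c).pow (k + 1)).div_const
          ((k + 1).factorial : ℝ)).mul_const (G (k + 1) c)
        refine this.congr_deriv ?_
        have hk : (k.factorial : ℝ) ≠ 0 := by positivity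
        rw [Nat.factorial_succ]
        push_cast
        simp only [id]
        field_simp
      have h2 := (HasDerivAt.fun_sum h1).hasDerivWithinAt (s := Set.Icc a b)
      have h3 := h2.add_const (G 0 c)
      refine h3.congr_of_eventuallyEq_of_mem ?_ hz
      refine Filter.Eventually.of_forall fun w => ?_
      simp only
      rw [Finset.sum_range_succ' _ (m + 1)]
      simp
    have hHc : H c = 0 := by
      simp only [hH]
      rw [Finset.sum_range_succ']
      simp
    have hB := (convex_Icc a b).norm_image_sub_le_of_norm_hasDerivWithin_le hd
      (fun z hz => (Real.norm_eq_abs _).trans_le (ih' z hz)) hc hs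
    rw [hHc, sub_zero, Real.norm_eq_abs, Real.norm_eq_abs] at hB
    refine hB.trans ?_
    have hI : 0 ≤ ∫ x in a..b, |G (m + 1 + 1) x| :=
      intervalIntegral.integral_nonneg hab fun _ _ => abs_nonneg _
    have habs : |s - c| ≤ b - a :=
      abs_sub_le_iff.2 ⟨by linarith [hs.2, hc.1], by linarith [hs.1, hc.2]⟩
    have hba : 0 ≤ b - a := sub_nonneg.2 hab
    calc (b - a) ^ m * (∫ x in a..b, |G (m + 1 + 1) x|) * |s - c|
        ≤ (b - a) ^ m * (∫ x in a..b, |G (m + 1 + 1) x|) * (b - a) := by gcongr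
      _ = _ := by ring

/-- `G 0, …, G (m + 1)` are successive derivatives on `[a, b]`, the last one continuous. -/
structure DerivChain (m : ℕ) (G : ℕ → ℝ → ℝ) (a b : ℝ) : Prop where
  deriv : ∀ k ≤ m, ∀ s ∈ Set.Icc a b, HasDerivWithinAt (G k) (G (k + 1) s) (Set.Icc a b) s
  cont : ContinuousOn (G (m + 1)) (Set.Icc a b)

theorem DerivChain.mono {m : ℕ} {G : ℕ → ℝ → ℝ} {a b a' b' : ℝ} (h : DerivChain m G a b)
    (ha : a ≤ a') (hb : b' ≤ b) : DerivChain m G a' b' :=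
  have hs : Set.Icc a' b' ⊆ Set.Icc a b := Set.Icc_subset_Icc ha hb
  ⟨fun k hk s hx => (h.deriv k hk s (hs hx)).mono hs, h.cont.mono hs⟩

theorem DerivChain.shift {m : ℕ} {G : ℕ → ℝ → ℝ} {a b : ℝ} (h : DerivChain (m + 1) G a b) :
    DerivChain m (fun k => G (k + 1)) a b :=
  ⟨fun k hk => h.deriv (k + 1) (by omega), h.cont⟩

theorem DerivChain.taylor {m : ℕ} {G : ℕ → ℝ → ℝ} {a b : ℝ} (h : DerivChain m G a b)
    (hab : a ≤ b) {c : ℝ} (hc : c ∈ Set.Icc a b) {s : ℝ} (hs : s ∈ Set.Icc a b) :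
    |G 0 s - ∑ k ∈ Finset.range (m + 1), (s - c) ^ k / (k.factorial : ℝ) * G k c| ≤
      (b - a) ^ m * ∫ x in a..b, |G (m + 1) x| :=
  abs_sub_taylor_le hab hc m G h.deriv h.cont hs

theorem bdf1_truncation {G : ℕ → ℝ → ℝ} {c s : ℝ} (hs : 0 < s) (h : DerivChain 1 G c (c + s)) :
    |1 / s * (G 0 (c + s) - G 0 c) - G 1 (c + s)| ≤ 2 * ∫ x in c..c + s, |G 2 x| := by
  have hab : c ≤ c + s := by linarith
  have e1 := h.taylor hab (Set.left_mem_Icc.2 hab) (Set.right_mem_Icc.2 hab)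
  have e2 := h.shift.taylor hab (Set.left_mem_Icc.2 hab) (Set.right_mem_Icc.2 hab)
  simp only [Finset.sum_range_succ, Finset.sum_range_zero, add_sub_cancel_left, pow_zero, zero_add,
    Nat.factorial, Nat.cast_one, div_one, one_mul, pow_one, Nat.reduceAdd, mul_one] at e1 e2
  set I := ∫ x in c..c + s, |G 2 x|
  have e3 : 1 / s * (G 0 (c + s) - G 0 c) - G 1 (c + s) =
      1 / s * (G 0 (c + s) - (G 0 c + s * G 1 c)) - (G 1 (c + s) - G 1 c) := by
    field_simp; ring
  rw [e3]
  refine (abs_sub _ _).trans ?_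
  rw [abs_mul, abs_of_pos (by positivity : 0 < 1 / s)]
  calc _ ≤ 1 / s * (s * I) + I := by gcongr
    _ = 2 * I := by field_simp; ring

/-- Quadratic Taylor polynomials at the middle node c cancel by exactness. The coefficients of the
two remainders are at most 2/s and 1/m for every ratio s/m, so no ratio bound enters. -/
theorem bdf2_truncation {G : ℕ → ℝ → ℝ} {c s m : ℝ} (hs : 0 < s) (hm : 0 < m)
    (h : DerivChain 2 G (c - m) (c + s)) :
    |(1 + 2 * (s / m)) / (s * (1 + s / m)) * (G 0 (c + s) - G 0 c) +
        -((s / m) ^ 2) / (s * (1 + s / m)) * (G 0 c - G 0 (c - m)) - G 1 (c + s)| ≤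
      3 * (s * (∫ x in c..c + s, |G 3 x|) + m * ∫ x in c - m..c, |G 3 x|) := by
  have hab : c ≤ c + s := by linarith
  have hab' : c - m ≤ c := by linarith
  have hr := h.mono hab' le_rfl
  have hl := h.mono le_rfl hab
  have e1 := hr.taylor hab (Set.left_mem_Icc.2 hab) (Set.right_mem_Icc.2 hab)
  have e2 := hr.shift.taylor hab (Set.left_mem_Icc.2 hab) (Set.right_mem_Icc.2 hab)
  have e3 := hl.taylor hab' (Set.right_mem_Icc.2 hab') (Set.left_mem_Icc.2 hab')
  have hI : 0 ≤ ∫ x in c..c + s, |G 3 x| :=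
    intervalIntegral.integral_nonneg hab fun _ _ => abs_nonneg _
  have hJ : 0 ≤ ∫ x in c - m..c, |G 3 x| :=
    intervalIntegral.integral_nonneg hab' fun _ _ => abs_nonneg _
  simp only [Finset.sum_range_succ, Finset.sum_range_zero, add_sub_cancel_left, pow_zero, zero_add,
    Nat.factorial, Nat.cast_one, div_one, one_mul, pow_one, Nat.reduceAdd, mul_one, sub_sub_cancel,
    sub_sub_cancel_left, Nat.succ_eq_add_one, Nat.cast_ofNat] at e1 e2 e3
  set I := ∫ x in c..c + s, |G 3 x|
  set J := ∫ x in c - m..c, |G 3 x|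
  have e4 : (1 + 2 * (s / m)) / (s * (1 + s / m)) * (G 0 (c + s) - G 0 c) +
        -((s / m) ^ 2) / (s * (1 + s / m)) * (G 0 c - G 0 (c - m)) - G 1 (c + s) =
      (1 + 2 * (s / m)) / (s * (1 + s / m)) *
        (G 0 (c + s) - (G 0 c + s * G 1 c + s ^ 2 / 2 * G 2 c)) +
      (s / m) ^ 2 / (s * (1 + s / m)) *
        (G 0 (c - m) - (G 0 c + -m * G 1 c + (-m) ^ 2 / 2 * G 2 c)) -
      (G 1 (c + s) - (G 1 c + s * G 2 c)) := by
    field_simp; ring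
  rw [e4]
  have b0 : (1 + 2 * (s / m)) / (s * (1 + s / m)) ≤ 2 / s := by
    rw [div_le_div_iff₀ (by positivity) hs]
    nlinarith [mul_pos hs (div_pos hs hm)]
  have b1 : (s / m) ^ 2 / (s * (1 + s / m)) ≤ 1 / m := by
    rw [div_le_div_iff₀ (by positivity) hm, ← sub_nonneg]
    have : 1 * (s * (1 + s / m)) - (s / m) ^ 2 * m = s := by field_simp; ring
    rw [this]; exact hs.le
  refine (abs_sub _ _).trans (add_le_add_left (abs_add_le _ _) _ |>.trans ?_)
  rw [abs_mul, abs_mul, abs_of_pos (by positivity : 0 < (1 + 2 * (s / m)) / (s * (1 + s / m))),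
    abs_of_pos (by positivity : 0 < (s / m) ^ 2 / (s * (1 + s / m)))]
  calc _ ≤ 2 / s * (s ^ 2 * I) + 1 / m * (m ^ 2 * J) + s * I := by gcongr
    _ = 3 * (s * I) + m * J := by field_simp; ring
    _ ≤ _ := by nlinarith [mul_nonneg hm.le hJ]

/-- The BDF3 coefficients are exact on cubic polynomials. -/
theorem kernel3_exact {s m p : ℝ} (hs : 0 < s) (hm : 0 < m) (hp : 0 < p) (A B C : ℝ) :
    kernel3 s (s / m) (m / p) 0 * (s * A + s ^ 2 * B + s ^ 3 * C) -
      kernel3 s (s / m) (m / p) 1 * (-m * A + (-m) ^ 2 * B + (-m) ^ 3 * C) +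
      kernel3 s (s / m) (m / p) 2 * ((-m * A + (-m) ^ 2 * B + (-m) ^ 3 * C) -
        (-(m + p) * A + (-(m + p)) ^ 2 * B + (-(m + p)) ^ 3 * C)) =
      A + 2 * s * B + 3 * s ^ 2 * C := by
  simp only [kernel3, den]
  have : 0 < 1 + m / p + s / m * (m / p) := by positivity
  have e : 1 + m / p + s / m * (m / p) = (p + m + s) / p := by field_simp
  rw [e]
  field_simp
  ring

-- Exactness on cubics leaves only Taylor remainders at c = t_{n-1}. Unlike for BDF2, the weights on
-- the older intervals grow with the step ratios; the bounds by 40 and the constant 10^12 account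
-- for this.
set_option maxHeartbeats 1000000 in
theorem bdf3_truncation {G : ℕ → ℝ → ℝ} {c s m p : ℝ} (hs : 0 < s) (hm : 0 < m) (hp : 0 < p)
    (hsm : s ≤ 40 * m) (hmp : m ≤ 40 * p) (h : DerivChain 3 G (c - (m + p)) (c + s)) :
    |kernel3 s (s / m) (m / p) 0 * (G 0 (c + s) - G 0 c) +
        kernel3 s (s / m) (m / p) 1 * (G 0 c - G 0 (c - m)) +
        kernel3 s (s / m) (m / p) 2 * (G 0 (c - m) - G 0 (c - (m + p))) - G 1 (c + s)| ≤
      10 ^ 12 * (s ^ 2 * (∫ x in c..c + s, |G 4 x|) + m ^ 2 * (∫ x in c - m..c, |G 4 x|) +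
        p ^ 2 * ∫ x in c - (m + p)..c - m, |G 4 x|) := by
  have hab : c ≤ c + s := by linarith
  have hab1 : c - m ≤ c := by linarith
  have hab2 : c - (m + p) ≤ c - m := by linarith
  have hr := h.mono (hab2.trans hab1) le_rfl
  have hl := h.mono le_rfl hab
  have hl1 := h.mono hab2 hab
  have e1 := hr.taylor hab (Set.left_mem_Icc.2 hab) (Set.right_mem_Icc.2 hab)
  have e2 := hr.shift.taylor hab (Set.left_mem_Icc.2 hab) (Set.right_mem_Icc.2 hab)
  have e3 := hl1.taylor hab1 (Set.right_mem_Icc.2 hab1) (Set.left_mem_Icc.2 hab1)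
  have e4 := hl.taylor (hab2.trans hab1) (Set.right_mem_Icc.2 (hab2.trans hab1))
    (Set.left_mem_Icc.2 (hab2.trans hab1))
  have hI : 0 ≤ ∫ x in c..c + s, |G 4 x| :=
    intervalIntegral.integral_nonneg hab fun _ _ => abs_nonneg _
  have hJ : 0 ≤ ∫ x in c - m..c, |G 4 x| :=
    intervalIntegral.integral_nonneg hab1 fun _ _ => abs_nonneg _
  have hL : 0 ≤ ∫ x in c - (m + p)..c - m, |G 4 x| :=
    intervalIntegral.integral_nonneg hab2 fun _ _ => abs_nonneg _
  have hsplit : ∫ x in c - (m + p)..c, |G 4 x| =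
      (∫ x in c - (m + p)..c - m, |G 4 x|) + ∫ x in c - m..c, |G 4 x| := by
    refine (intervalIntegral.integral_add_adjacent_intervals ?_ ?_).symm
    · exact (continuous_abs.comp_continuousOn
        (h.mono le_rfl (hab1.trans hab)).cont).intervalIntegrable_of_Icc hab2
    · exact (continuous_abs.comp_continuousOn hl1.cont).intervalIntegrable_of_Icc hab1
  simp only [Finset.sum_range_succ, Finset.sum_range_zero, add_sub_cancel_left, pow_zero, zero_add,
    Nat.factorial, Nat.cast_one, div_one, one_mul, pow_one, Nat.reduceAdd, mul_one, sub_sub_cancel,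
    sub_sub_cancel_left, Nat.succ_eq_add_one, Nat.cast_ofNat, Nat.reduceMul, hsplit]
    at e1 e2 e3 e4
  set I := ∫ x in c..c + s, |G 4 x|
  set J := ∫ x in c - m..c, |G 4 x|
  set L := ∫ x in c - (m + p)..c - m, |G 4 x|
  have hr0 : 0 ≤ s / m := by positivity
  have hq0 : 0 ≤ m / p := by positivity
  have hr40 : s / m ≤ 40 := (div_le_iff₀ hm).2 hsm
  have hq40 : m / p ≤ 40 := (div_le_iff₀ hp).2 hmp
  have k0 := kernel3_zero_nonneg hs hr0 hq0
  have k0' := kernel3_zero_le hs hr0 hq0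
  have k1 := neg_kernel3_one_le hs hr0 hq0
  have k1' : 0 ≤ -kernel3 s (s / m) (m / p) 1 :=
    le_trans (by positivity) (le_neg_kernel3_one hs hr0 hq0)
  have k2 := kernel3_two_nonneg hs hr0 hq0
  have k2' := kernel3_two_le hs hr0 hq0
  have hex := kernel3_exact hs hm hp (G 1 c) (G 2 c / 2) (G 3 c / 6)
  have b1 : 4 * (s / m) ^ 2 / s * m ^ 3 ≤ 160 * m ^ 2 := by
    have : 4 * (s / m) ^ 2 / s * m ^ 3 = 4 * s * m := by field_simp
    rw [this]; nlinarith
  -- The factor q³ = (m/p)³ of b_2 combines with (m + p)³ into m³ (1 + q)³, leaving 40 · 41 · 41³ <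
  -- 2 · 10^8.
  have b2 : (s / m) ^ 2 * (m / p) ^ 3 * (1 + s / m) / s * (m + p) ^ 3 ≤ 2 * 10 ^ 8 * m ^ 2 := by
    have : (s / m) ^ 2 * (m / p) ^ 3 * (1 + s / m) / s * (m + p) ^ 3 =
        (s / m * (1 + s / m) * (1 + m / p) ^ 3) * m ^ 2 := by field_simp; ring
    rw [this]
    refine mul_le_mul_of_nonneg_right ?_ (sq_nonneg m)
    calc s / m * (1 + s / m) * (1 + m / p) ^ 3 ≤ 40 * (1 + 40) * (1 + 40) ^ 3 := by gcongr
      _ ≤ _ := by norm_num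
  have b3 : m ^ 2 ≤ 1600 * p ^ 2 := by nlinarith
  generalize kernel3 s (s / m) (m / p) 0 = K0 at *
  generalize kernel3 s (s / m) (m / p) 1 = K1 at *
  generalize kernel3 s (s / m) (m / p) 2 = K2 at *
  -- The node c - m occurs in two increments, hence the weight -K1 + K2 of its remainder.
  have e5 : K0 * (G 0 (c + s) - G 0 c) + K1 * (G 0 c - G 0 (c - m)) +
        K2 * (G 0 (c - m) - G 0 (c - (m + p))) - G 1 (c + s) =
      K0 * (G 0 (c + s) - (G 0 c + s * G 1 c + s ^ 2 / 2 * G 2 c + s ^ 3 / 6 * G 3 c)) +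
      (-K1 + K2) * (G 0 (c - m) -
        (G 0 c + -m * G 1 c + (-m) ^ 2 / 2 * G 2 c + (-m) ^ 3 / 6 * G 3 c)) -
      K2 * (G 0 (c - (m + p)) - (G 0 c + -(m + p) * G 1 c + (-(m + p)) ^ 2 / 2 * G 2 c +
        (-(m + p)) ^ 3 / 6 * G 3 c)) -
      (G 1 (c + s) - (G 1 c + s * G 2 c + s ^ 2 / 2 * G 3 c)) := by
    linear_combination hex
  rw [e5]
  refine (abs_sub _ _).trans (add_le_add_left ((abs_sub _ _).trans
    (add_le_add_left (abs_add_le _ _) _)) _ |>.trans ?_)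
  rw [abs_mul, abs_mul, abs_mul, abs_of_nonneg k0, abs_of_nonneg (add_nonneg k1' k2),
    abs_of_nonneg k2]
  have hmp3 : m ^ 3 ≤ (m + p) ^ 3 := by gcongr; linarith
  have t1 : K0 * (s ^ 3 * I) ≤ 3 * (s ^ 2 * I) := by
    calc K0 * (s ^ 3 * I) ≤ 3 / s * (s ^ 3 * I) := by gcongr
      _ = 3 * (s ^ 2 * I) := by field_simp
  have t2 : -K1 * m ^ 3 ≤ 160 * m ^ 2 := (mul_le_mul_of_nonneg_right k1 (by positivity)).trans b1
  have t3 : K2 * (m + p) ^ 3 ≤ 2 * 10 ^ 8 * m ^ 2 :=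
    (mul_le_mul_of_nonneg_right k2' (by positivity)).trans b2
  have t4 : K2 * m ^ 3 ≤ 2 * 10 ^ 8 * m ^ 2 := (mul_le_mul_of_nonneg_left hmp3 k2).trans t3
  calc _ ≤ K0 * (s ^ 3 * I) + (-K1 + K2) * (m ^ 3 * J) +
        K2 * ((m + p) ^ 3 * (L + J)) + s ^ 2 * I := by
        have e4' : |G 0 (c - (m + p)) - (G 0 c + -(m + p) * G 1 c + (-(m + p)) ^ 2 / 2 * G 2 c +
          (-(m + p)) ^ 3 / 6 * G 3 c)| ≤ (m + p) ^ 3 * (L + J) := e4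
        gcongr
    _ = K0 * (s ^ 3 * I) + (-K1 * m ^ 3 + K2 * m ^ 3) * J +
        K2 * (m + p) ^ 3 * (L + J) + s ^ 2 * I := by ring
    _ ≤ 3 * (s ^ 2 * I) + (160 * m ^ 2 + 2 * 10 ^ 8 * m ^ 2) * J +
        2 * 10 ^ 8 * m ^ 2 * (L + J) + s ^ 2 * I := by gcongr
    _ = 4 * (s ^ 2 * I) + (160 + 4 * 10 ^ 8) * (m ^ 2 * J) + 2 * 10 ^ 8 * m ^ 2 * L := by ring
    _ ≤ 4 * (s ^ 2 * I) + (160 + 4 * 10 ^ 8) * (m ^ 2 * J) +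
        2 * 10 ^ 8 * (1600 * p ^ 2) * L := by gcongr
    _ ≤ _ := by linarith [mul_nonneg (sq_nonneg s) hI, mul_nonneg (sq_nonneg m) hJ,
                  mul_nonneg (sq_nonneg p) hL]

section

/-! ### Integration over the periodic box -/

open MeasureTheory

variable {d : ℕ} {ℓ : Fin d → ℝ}

/-- The closed box. -/
def closedBox (ℓ : Fin d → ℝ) : Set (EuclideanSpace ℝ (Fin d)) := {x | ∀ i, x i ∈ Set.Icc 0 (ℓ i)}

theorem closedBox_eq_image (ℓ : Fin d → ℝ) :
    closedBox ℓ = WithLp.toLp 2 '' Set.Icc (0 : Fin d → ℝ) ℓ := by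
  ext x
  constructor
  · intro hx
    exact ⟨WithLp.ofLp x, ⟨fun i => (hx i).1, fun i => (hx i).2⟩, rfl⟩
  · rintro ⟨y, hy, rfl⟩ i
    exact ⟨hy.1 i, hy.2 i⟩

theorem isCompact_closedBox (ℓ : Fin d → ℝ) : IsCompact (closedBox ℓ) := by
  rw [closedBox_eq_image]
  exact isCompact_Icc.image (PiLp.continuous_toLp 2 _)

theorem box_subset_closedBox (ℓ : Fin d → ℝ) : box ℓ ⊆ closedBox ℓ :=
  fun _ hx i => Set.Ioo_subset_Icc_self (hx i)

theorem measurableEmbedding_toLp (d : ℕ) :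
    MeasurableEmbedding (WithLp.toLp 2 : (Fin d → ℝ) → EuclideanSpace ℝ (Fin d)) :=
  (MeasurableEquiv.toLp 2 (Fin d → ℝ)).measurableEmbedding

theorem setIntegral_box (g : EuclideanSpace ℝ (Fin d) → ℝ) :
    ∫ x in box ℓ, g x = ∫ y in Set.Icc (0 : Fin d → ℝ) ℓ, g (WithLp.toLp 2 y) := by
  rw [← (PiLp.volume_preserving_toLp (Fin d)).setIntegral_preimage_emb
    (measurableEmbedding_toLp d) g (box ℓ)]
  have : (WithLp.toLp 2 ⁻¹' box ℓ : Set (Fin d → ℝ)) = Set.univ.pi fun i => Set.Ioo 0 (ℓ i) := by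
    ext y; simp [box, Set.mem_pi]
  rw [this]
  exact setIntegral_congr_set Measure.univ_pi_Ioo_ae_eq_Icc

theorem setIntegral_box_eq_closedBox (g : EuclideanSpace ℝ (Fin d) → ℝ) :
    ∫ x in box ℓ, g x = ∫ x in closedBox ℓ, g x := by
  rw [setIntegral_box, ← (PiLp.volume_preserving_toLp (Fin d)).setIntegral_preimage_emb
    (measurableEmbedding_toLp d) g (closedBox ℓ), closedBox_eq_image,
    Set.preimage_image_eq _ (measurableEmbedding_toLp d).injective]

theorem integrableOn_box {g : EuclideanSpace ℝ (Fin d) → ℝ} (hg : Continuous g) :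
    IntegrableOn g (box ℓ) :=
  (hg.continuousOn.integrableOn_compact (isCompact_closedBox ℓ)).mono_set (box_subset_closedBox ℓ)

theorem IsPeriodic.fderiv_apply {w : EuclideanSpace ℝ (Fin d) → ℝ} (hw : IsPeriodic ℓ w)
    (e : EuclideanSpace ℝ (Fin d)) : IsPeriodic ℓ fun x => fderiv ℝ w x e := by
  intro i x
  have : (fun y => w (y + EuclideanSpace.single i (ℓ i))) = w := funext (hw i)
  simp only
  rw [← fderiv_comp_add_right, this]

theorem IsPeriodic.mul {v w : EuclideanSpace ℝ (Fin d) → ℝ} (hv : IsPeriodic ℓ v)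
    (hw : IsPeriodic ℓ w) : IsPeriodic ℓ fun x => v x * w x := fun i x => by
  simp only [hv i x, hw i x]

theorem IsPeriodic.sub {v w : EuclideanSpace ℝ (Fin d) → ℝ} (hv : IsPeriodic ℓ v)
    (hw : IsPeriodic ℓ w) : IsPeriodic ℓ fun x => v x - w x := fun i x => by
  simp only [hv i x, hw i x]

/-- The divergence theorem for periodic fields. -/
theorem integral_divergence_eq_zero (hℓ : ∀ i, 0 < ℓ i)
    {F : Fin d → EuclideanSpace ℝ (Fin d) → ℝ} (hF : ∀ i, ContDiff ℝ 1 (F i))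
    (hper : ∀ i, IsPeriodic ℓ (F i)) :
    ∫ x in box ℓ, ∑ i, fderiv ℝ (F i) x (EuclideanSpace.single i 1) = 0 := by
  rcases d with _ | n
  · simp
  set L : (Fin (n + 1) → ℝ) →L[ℝ] EuclideanSpace ℝ (Fin (n + 1)) :=
    (PiLp.continuousLinearEquiv 2 ℝ (fun _ : Fin (n + 1) => ℝ)).symm.toContinuousLinearMap
  have hd : ∀ i y, HasFDerivAt (fun y => F i (WithLp.toLp 2 y))
      ((fderiv ℝ (F i) (WithLp.toLp 2 y)).comp L) y := fun i y =>
    (((hF i).differentiable one_ne_zero) (WithLp.toLp 2 y)).hasFDerivAt.comp y L.hasFDerivAt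
  have hcont : ∀ i, Continuous fun y : Fin (n + 1) → ℝ =>
      fderiv ℝ (F i) (WithLp.toLp 2 y) (EuclideanSpace.single i 1) := fun i =>
    (((hF i).continuous_fderiv one_ne_zero).comp (PiLp.continuous_toLp 2 _)).clm_apply
      continuous_const
  have key := integral_divergence_of_hasFDerivAt_off_countable' (0 : Fin (n + 1) → ℝ) ℓ
    (fun i => (hℓ i).le) (fun i y => F i (WithLp.toLp 2 y))
    (fun i y => (fderiv ℝ (F i) (WithLp.toLp 2 y)).comp L) ∅ Set.countable_empty
    (fun i => ((hF i).continuous.comp (PiLp.continuous_toLp 2 _)).continuousOn)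
    (fun y _ i => hd i y)
    ((continuous_finsetSum _ fun i _ => hcont i).continuousOn.integrableOn_Icc)
  rw [setIntegral_box]
  refine key.trans (Finset.sum_eq_zero fun i _ => ?_)
  rw [sub_eq_zero]
  congr 1
  funext y
  -- A point of the face x_i = ℓ_i is the opposite point of x_i = 0 shifted by one period, so the
  -- two fluxes cancel.
  refine Eq.trans ?_ (hper i i _)
  congr 1
  ext j
  simp only [PiLp.add_apply, PiLp.single_apply]
  rcases eq_or_ne j i with rfl | hji
  · simp
  · obtain ⟨k, rfl⟩ := Fin.exists_succAbove_eq hji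
    simp [Fin.succAbove_ne]

/-- The Dirichlet form. -/
def dirichlet (ℓ : Fin d → ℝ) (v w : EuclideanSpace ℝ (Fin d) → ℝ) : ℝ :=
  ∫ x in box ℓ, ∑ i, fderiv ℝ v x (EuclideanSpace.single i 1) *
    fderiv ℝ w x (EuclideanSpace.single i 1)

theorem laplacian_eq_sum (v : EuclideanSpace ℝ (Fin d) → ℝ) (x : EuclideanSpace ℝ (Fin d)) :
    Laplacian.laplacian v x = ∑ i, fderiv ℝ (fderiv ℝ v) x (EuclideanSpace.single i 1)
      (EuclideanSpace.single i 1) := by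
  rw [InnerProductSpace.laplacian_eq_iteratedFDeriv_orthonormalBasis v
    (EuclideanSpace.basisFun (Fin d) ℝ)]
  simp [iteratedFDeriv_two_apply, EuclideanSpace.basisFun_apply]

theorem contDiff_fderiv_apply {v : EuclideanSpace ℝ (Fin d) → ℝ} (hv : ContDiff ℝ 2 v)
    (e : EuclideanSpace ℝ (Fin d)) : ContDiff ℝ 1 fun x => fderiv ℝ v x e :=
  (hv.fderiv_right (by norm_num [one_add_one_eq_two])).clm_apply contDiff_const

theorem continuous_laplacian {v : EuclideanSpace ℝ (Fin d) → ℝ} (hv : ContDiff ℝ 2 v) :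
    Continuous fun x => Laplacian.laplacian v x := by
  have h1 : ContDiff ℝ 1 (fderiv ℝ v) := hv.fderiv_right (by norm_num [one_add_one_eq_two])
  simp only [laplacian_eq_sum]
  exact continuous_finsetSum _ fun i _ =>
    ((h1.continuous_fderiv one_ne_zero).clm_apply continuous_const).clm_apply continuous_const

/-- Green's formula for periodic functions. -/
theorem integral_laplacian_mul (hℓ : ∀ i, 0 < ℓ i) {v w : EuclideanSpace ℝ (Fin d) → ℝ}
    (hv : ContDiff ℝ 2 v) (hw : ContDiff ℝ 1 w) (hvp : IsPeriodic ℓ v) (hwp : IsPeriodic ℓ w) :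
    ∫ x in box ℓ, Laplacian.laplacian v x * w x = -dirichlet ℓ v w := by
  have h1 : ContDiff ℝ 1 (fderiv ℝ v) := hv.fderiv_right (by norm_num [one_add_one_eq_two])
  have h := integral_divergence_eq_zero hℓ
    (F := fun i x => fderiv ℝ v x (EuclideanSpace.single i 1) * w x)
    (fun i => (contDiff_fderiv_apply hv _).mul hw) (fun i => (hvp.fderiv_apply _).mul hwp)
  have hd : ∀ i x, fderiv ℝ (fun x => fderiv ℝ v x (EuclideanSpace.single i 1) * w x) x
      (EuclideanSpace.single i 1) =
      fderiv ℝ (fderiv ℝ v) x (EuclideanSpace.single i 1) (EuclideanSpace.single i 1) * w x +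
      fderiv ℝ v x (EuclideanSpace.single i 1) * fderiv ℝ w x (EuclideanSpace.single i 1) := by
    intro i x
    have e1 := ((h1.differentiable one_ne_zero x).hasFDerivAt.clm_apply
      (hasFDerivAt_const (EuclideanSpace.single i (1 : ℝ)) x)).mul
      ((hw.differentiable one_ne_zero x).hasFDerivAt)
    rw [HasFDerivAt.fderiv (f := fun x => fderiv ℝ v x (EuclideanSpace.single i 1) * w x) e1]
    simp
    ring
  simp only [hd, Finset.sum_add_distrib, ← Finset.sum_mul, ← laplacian_eq_sum] at h
  have i1 : IntegrableOn (fun x => Laplacian.laplacian v x * w x) (box ℓ) :=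
    integrableOn_box ((continuous_laplacian hv).mul hw.continuous)
  have i2 : IntegrableOn (fun x => ∑ i, fderiv ℝ v x (EuclideanSpace.single i 1) *
      fderiv ℝ w x (EuclideanSpace.single i 1)) (box ℓ) :=
    integrableOn_box (continuous_finsetSum _ fun i _ =>
      (contDiff_fderiv_apply hv _).continuous.mul
        ((hw.continuous_fderiv one_ne_zero).clm_apply continuous_const))
  rw [integral_add i1 i2] at h
  rw [dirichlet]
  linarith

theorem dirichlet_self_nonneg (v : EuclideanSpace ℝ (Fin d) → ℝ) : 0 ≤ dirichlet ℓ v v :=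
  integral_nonneg fun _ => Finset.sum_nonneg fun _ _ => mul_self_nonneg _

/-- From a (a - b) ≥ (a² - b²)/2 in each partial derivative; this makes the diffusion term telescope
in time. -/
theorem dirichlet_sub_le {v w : EuclideanSpace ℝ (Fin d) → ℝ} (hv : ContDiff ℝ 1 v)
    (hw : ContDiff ℝ 1 w) :
    (dirichlet ℓ v v - dirichlet ℓ w w) / 2 ≤ dirichlet ℓ v fun x => v x - w x := by
  have hc : ∀ {f g : EuclideanSpace ℝ (Fin d) → ℝ}, ContDiff ℝ 1 f → ContDiff ℝ 1 g →
      IntegrableOn (fun x => ∑ i, fderiv ℝ f x (EuclideanSpace.single i 1) *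
        fderiv ℝ g x (EuclideanSpace.single i 1)) (box ℓ) := fun hf hg =>
    integrableOn_box (continuous_finsetSum _ fun i _ =>
      ((hf.continuous_fderiv one_ne_zero).clm_apply continuous_const).mul
        ((hg.continuous_fderiv one_ne_zero).clm_apply continuous_const))
  rw [dirichlet, dirichlet, dirichlet, ← integral_sub (hc hv hv) (hc hw hw), ← integral_div]
  refine integral_mono (((hc hv hv).sub (hc hw hw)).div_const 2) (hc hv (hv.sub hw)) fun x => ?_
  simp only
  rw [← Finset.sum_sub_distrib, Finset.sum_div]
  refine Finset.sum_le_sum fun i _ => ?_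
  rw [fderiv_fun_sub (hv.differentiable one_ne_zero x) (hw.differentiable one_ne_zero x),
    _root_.sub_apply]
  nlinarith [sq_nonneg (fderiv ℝ v x (EuclideanSpace.single i 1) -
    fderiv ℝ w x (EuclideanSpace.single i 1))]

/-! ### The norm of `L²(Ω)` -/

theorem normL2_nonneg (w : EuclideanSpace ℝ (Fin d) → ℝ) : 0 ≤ normL2 ℓ w := Real.sqrt_nonneg _

theorem normL2_sq (w : EuclideanSpace ℝ (Fin d) → ℝ) : normL2 ℓ w ^ 2 = ∫ x in box ℓ, w x ^ 2 :=
  Real.sq_sqrt (integral_nonneg fun _ => sq_nonneg _)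

theorem normL2_mono {v w : EuclideanSpace ℝ (Fin d) → ℝ} (hv : Continuous v) (hw : Continuous w)
    (h : ∀ x, |v x| ≤ w x) : normL2 ℓ v ≤ normL2 ℓ w :=
  Real.sqrt_le_sqrt (integral_mono (integrableOn_box (hv.pow 2)) (integrableOn_box (hw.pow 2))
    fun x => sq_le_sq.2 ((h x).trans (le_abs_self _)))

theorem normL2_const_mul {c : ℝ} (hc : 0 ≤ c) (v : EuclideanSpace ℝ (Fin d) → ℝ) :
    normL2 ℓ (fun x => c * v x) = c * normL2 ℓ v := by
  simp only [normL2, mul_pow]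
  rw [integral_const_mul, Real.sqrt_mul (sq_nonneg c), Real.sqrt_sq hc]

theorem normL2_abs (v : EuclideanSpace ℝ (Fin d) → ℝ) : normL2 ℓ (fun x => |v x|) = normL2 ℓ v := by
  simp only [normL2, sq_abs]

theorem integral_mul_le_normL2_mul {v w : EuclideanSpace ℝ (Fin d) → ℝ} (hv : Continuous v)
    (hw : Continuous w) : ∫ x in box ℓ, v x * w x ≤ normL2 ℓ v * normL2 ℓ w := by
  have key : ∀ s : ℝ, 0 ≤ (normL2 ℓ v ^ 2) * (s * s) + (2 * ∫ x in box ℓ, v x * w x) * s +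
      normL2 ℓ w ^ 2 := by
    intro s
    have h : 0 ≤ ∫ x in box ℓ, (s * v x + w x) ^ 2 := integral_nonneg fun _ => sq_nonneg _
    have e : ∀ x, (s * v x + w x) ^ 2 = (s * s * v x ^ 2 + 2 * s * (v x * w x)) + w x ^ 2 :=
      fun x => by ring
    simp only [e] at h
    rw [integral_add (integrableOn_box (by fun_prop)) (integrableOn_box (by fun_prop)),
      integral_add (integrableOn_box (by fun_prop)) (integrableOn_box (by fun_prop)),
      integral_const_mul, integral_const_mul] at h
    rw [normL2_sq, normL2_sq]
    linarith
  have h := discrim_le_zero key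
  rw [discrim] at h
  refine le_of_sq_le_sq ?_ (mul_nonneg (normL2_nonneg _) (normL2_nonneg _))
  rw [mul_pow]
  linarith

theorem normL2_add_le {v w : EuclideanSpace ℝ (Fin d) → ℝ} (hv : Continuous v)
    (hw : Continuous w) : normL2 ℓ (fun x => v x + w x) ≤ normL2 ℓ v + normL2 ℓ w := by
  refine le_of_sq_le_sq ?_ (add_nonneg (normL2_nonneg _) (normL2_nonneg _))
  have e : ∀ x, (v x + w x) ^ 2 = (v x ^ 2 + 2 * (v x * w x)) + w x ^ 2 := fun x => by ring
  rw [normL2_sq]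
  simp only [e]
  rw [integral_add (integrableOn_box (by fun_prop)) (integrableOn_box (by fun_prop)),
    integral_add (integrableOn_box (by fun_prop)) (integrableOn_box (by fun_prop)),
    integral_const_mul, ← normL2_sq, ← normL2_sq]
  nlinarith [integral_mul_le_normL2_mul (ℓ := ℓ) hv hw]

/-! ### Jointly continuous functions of time and space -/

theorem continuous_integral_box {k : ℝ → EuclideanSpace ℝ (Fin d) → ℝ}
    (hk : Continuous (Function.uncurry k)) : Continuous fun s => ∫ x in box ℓ, k s x := by
  simp only [setIntegral_box_eq_closedBox]
  exact continuous_parametric_integral_of_continuous hk (isCompact_closedBox ℓ)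

theorem continuous_normL2 {k : ℝ → EuclideanSpace ℝ (Fin d) → ℝ}
    (hk : Continuous (Function.uncurry k)) : Continuous fun s => normL2 ℓ (k s) :=
  Real.continuous_sqrt.comp (continuous_integral_box (k := fun s x => k s x ^ 2) (hk.pow 2))

theorem continuous_time_integral {k : ℝ → EuclideanSpace ℝ (Fin d) → ℝ}
    (hk : Continuous (Function.uncurry k)) (a b : ℝ) : Continuous fun x => ∫ s in a..b, k s x :=
  intervalIntegral.continuous_parametric_intervalIntegral_of_continuous' (f := fun x s => k s x)
    (hk.comp continuous_swap) a b

theorem integral_box_swap {k : ℝ → EuclideanSpace ℝ (Fin d) → ℝ}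
    (hk : Continuous (Function.uncurry k)) (a b : ℝ) :
    ∫ s in a..b, ∫ x in box ℓ, k s x = ∫ x in box ℓ, ∫ s in a..b, k s x := by
  refine intervalIntegral_integral_swap ?_
  rw [Measure.prod_restrict]
  exact (hk.continuousOn.integrableOn_compact
    (isCompact_uIcc.prod (isCompact_closedBox ℓ))).mono_set
    (Set.prod_mono Set.uIoc_subset_uIcc (box_subset_closedBox ℓ))

/-- Minkowski's integral inequality. -/
theorem normL2_integral_le {k : ℝ → EuclideanSpace ℝ (Fin d) → ℝ}
    (hk : Continuous (Function.uncurry k)) {a b : ℝ} (hab : a ≤ b) :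
    normL2 ℓ (fun x => ∫ s in a..b, k s x) ≤ ∫ s in a..b, normL2 ℓ (k s) := by
  set h : EuclideanSpace ℝ (Fin d) → ℝ := fun x => ∫ s in a..b, k s x with hh
  have hc : Continuous h := continuous_time_integral hk a b
  have hks : ∀ s, Continuous (k s) := fun s => hk.comp (by fun_prop : Continuous fun x => (s, x))
  have hR : 0 ≤ ∫ s in a..b, normL2 ℓ (k s) :=
    intervalIntegral.integral_nonneg hab fun _ _ => normL2_nonneg _
  rcases (normL2_nonneg (ℓ := ℓ) h).eq_or_lt with h0 | h0
  · rw [← h0]; exact hR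
  -- Duality: the inequality is multiplied by ‖h‖, and ‖h‖² is the time integral of the pairings of
  -- h with k s, each at most ‖h‖ ‖k s‖.
  refine le_of_mul_le_mul_left ?_ h0
  have e1 : normL2 ℓ h * normL2 ℓ h = ∫ x in box ℓ, ∫ s in a..b, h x * k s x := by
    rw [← sq, normL2_sq]
    congr 1
    funext x
    rw [intervalIntegral.integral_const_mul, sq]
  have hk' : Continuous (Function.uncurry fun s x => h x * k s x) :=
    (hc.comp continuous_snd).mul hk
  rw [e1, ← integral_box_swap hk', ← intervalIntegral.integral_const_mul]
  exact intervalIntegral.integral_mono_on hab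
    ((continuous_integral_box hk').intervalIntegrable _ _)
    ((continuous_const.mul (continuous_normL2 hk)).intervalIntegrable _ _)
    fun s _ => integral_mul_le_normL2_mul hc (hks s)

end

section

/-! ### Classical solutions: regularity and uniqueness -/

open MeasureTheory

variable {d : ℕ} {ℓ : Fin d → ℝ}

theorem isOpen_box (ℓ : Fin d → ℝ) : IsOpen (box ℓ) := by
  simp only [box, Set.ofPred_forall]
  exact isOpen_iInter_of_finite fun i => isOpen_Ioo.preimage (by fun_prop)

section

variable {ε T : ℝ} {u₀ : EuclideanSpace ℝ (Fin d) → ℝ} {u : ℝ → EuclideanSpace ℝ (Fin d) → ℝ}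

/-- The time derivatives, extended by constants outside `[0, T]`. -/
def timeDerivExt (T : ℝ) (hT : 0 ≤ T) (u : ℝ → EuclideanSpace ℝ (Fin d) → ℝ) (k : ℕ) (s : ℝ)
    (x : EuclideanSpace ℝ (Fin d)) : ℝ :=
  timeDeriv T u k (Set.projIcc 0 T hT s) x

theorem timeDerivExt_of_mem (hT : 0 ≤ T) (k : ℕ) {s : ℝ} (hs : s ∈ Set.Icc 0 T) :
    timeDerivExt T hT u k s = timeDeriv T u k s := by
  funext x
  rw [timeDerivExt, Set.projIcc_of_mem hT hs]

theorem timeDeriv_zero (s : ℝ) : timeDeriv T u 0 s = u s := by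
  funext x
  rw [timeDeriv, iteratedDerivWithin_zero]

theorem IsSolution.continuous_ext (hu : IsSolution ℓ ε T u₀ u) (hT : 0 ≤ T) {k : ℕ} (hk : k ≤ 4) :
    Continuous (Function.uncurry (timeDerivExt T hT u k)) := by
  have h := hu.timeDeriv_continuous k hk
  have : Continuous fun p : ℝ × EuclideanSpace ℝ (Fin d) =>
      ((Set.projIcc 0 T hT p.1 : ℝ), p.2) :=
    (continuous_subtype_val.comp (continuous_projIcc.comp continuous_fst)).prodMk continuous_snd
  exact h.comp_continuous this fun p => ⟨(Set.projIcc 0 T hT p.1).2, Set.mem_univ _⟩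

theorem IsSolution.continuous_timeDeriv (hu : IsSolution ℓ ε T u₀ u) {k : ℕ} (hk : k ≤ 4) {s : ℝ}
    (hs : s ∈ Set.Icc 0 T) : Continuous (timeDeriv T u k s) :=
  (hu.timeDeriv_continuous k hk).comp_continuous (f := fun x => (s, x)) (by fun_prop)
    fun _ => ⟨hs, Set.mem_univ _⟩

theorem IsSolution.derivChain (hu : IsSolution ℓ ε T u₀ u) (hT : 0 < T) {m : ℕ} (hm : m + 1 ≤ 4)
    (x : EuclideanSpace ℝ (Fin d)) : DerivChain m (fun k s => timeDeriv T u k s x) 0 T := by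
  refine ⟨fun k hk s hs => ?_, ?_⟩
  · have hlt : (k : WithTop ℕ∞) < 4 := by exact_mod_cast (by omega : k < 4)
    have := ((hu.time_smooth x).differentiableOn_iteratedDerivWithin hlt
      (uniqueDiffOn_Icc hT) s hs).hasDerivWithinAt
    simpa only [timeDeriv, iteratedDerivWithin_succ] using this
  · exact (hu.time_smooth x).continuousOn_iteratedDerivWithin (by exact_mod_cast hm)
      (uniqueDiffOn_Icc hT)

/-- One-sided Lipschitz bound: the cube is monotone, so only the linear part -s contributes, without
any bound on a or b. -/
theorem sub_mul_force_sub_le (a b : ℝ) : -((a - b) * (force a - force b)) ≤ (a - b) ^ 2 := by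
  have : (a - b) ^ 2 + (a - b) * (force a - force b) =
      (a - b) ^ 2 * ((a + b / 2) ^ 2 + 3 / 4 * b ^ 2) := by
    unfold force; ring
  have h : 0 ≤ (a - b) ^ 2 * ((a + b / 2) ^ 2 + 3 / 4 * b ^ 2) := by positivity
  linarith

/-- A continuous function dominated by a multiple of its primitive is nonpositive. -/
theorem nonpos_of_le_integral {y : ℝ → ℝ} (hy : Continuous y) {T c : ℝ} (hc : 0 ≤ c)
    (h : ∀ b ∈ Set.Icc 0 T, y b ≤ c * ∫ s in (0 : ℝ)..b, y s) {b : ℝ} (hb : b ∈ Set.Icc 0 T) :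
    y b ≤ 0 := by
  set Y : ℝ → ℝ := fun b => ∫ s in (0 : ℝ)..b, y s with hY
  -- Integrating factor: exp(-cb) Y(b) is nonincreasing and vanishes at 0.
  have hd : ∀ b, HasDerivAt (fun b => Real.exp (-(c * b)) * Y b)
      (Real.exp (-(c * b)) * (y b - c * Y b)) b := by
    intro b
    have h1 : HasDerivAt Y (y b) b := intervalIntegral.integral_hasDerivAt_right
      (hy.intervalIntegrable _ _) (hy.stronglyMeasurableAtFilter _ _) hy.continuousAt
    have h2 := (((hasDerivAt_id b).const_mul c).neg.exp).mul h1
    refine h2.congr_deriv ?_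
    simp only [id, Pi.neg_apply]
    ring
  have hanti : AntitoneOn (fun b => Real.exp (-(c * b)) * Y b) (Set.Icc 0 T) := by
    refine antitoneOn_of_deriv_nonpos (convex_Icc 0 T)
      (fun b _ => (hd b).continuousAt.continuousWithinAt)
      (fun b _ => (hd b).differentiableAt.differentiableWithinAt) fun b hb => ?_
    rw [(hd b).deriv]
    exact mul_nonpos_of_nonneg_of_nonpos (Real.exp_pos _).le
      (sub_nonpos.2 (h b (interior_subset hb)))
  have h0 := hanti (Set.left_mem_Icc.2 (hb.1.trans hb.2)) hb hb.1
  simp only [hY, intervalIntegral.integral_same, mul_zero] at h0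
  have h1 : ∫ s in (0 : ℝ)..b, y s ≤ 0 := by
    by_contra! hcon
    exact absurd h0 (not_le.2 (mul_pos (Real.exp_pos _) hcon))
  exact (h b hb).trans (mul_nonpos_of_nonneg_of_nonpos hc h1)

/-- The energy inequality for the difference of two solutions. -/
theorem IsSolution.integral_sub_mul_le (hℓ : ∀ i, 0 < ℓ i) {w : ℝ → EuclideanSpace ℝ (Fin d) → ℝ}
    (hu : IsSolution ℓ ε T u₀ u) (hw : IsSolution ℓ ε T u₀ w) {s : ℝ} (hs : s ∈ Set.Ioc 0 T) :
    ∫ x in box ℓ, (u s x - w s x) * (timeDeriv T u 1 s x - timeDeriv T w 1 s x) ≤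
      ∫ x in box ℓ, (u s x - w s x) ^ 2 := by
  have hs' := Set.Ioc_subset_Icc_self hs
  have cu := hu.space_smooth s hs'
  have cw := hw.space_smooth s hs'
  have cd : ContDiff ℝ 2 fun x => u s x - w s x := cu.sub cw
  have hlap : ∀ x, Laplacian.laplacian (fun x => u s x - w s x) x =
      Laplacian.laplacian (u s) x - Laplacian.laplacian (w s) x := fun x =>
    ContDiffAt.laplacian_sub (cu.contDiffAt (x := x)) (cw.contDiffAt (x := x))
  have hp := (hu.periodic s hs').sub (hw.periodic s hs')
  have green := integral_laplacian_mul hℓ cd (cd.of_le (by norm_num)) hp hp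
  have hD := dirichlet_self_nonneg (ℓ := ℓ) fun x => u s x - w s x
  have c1 : Continuous fun x => timeDeriv T u 1 s x :=
    hu.continuous_timeDeriv (by norm_num) hs'
  have c2 : Continuous fun x => timeDeriv T w 1 s x :=
    hw.continuous_timeDeriv (by norm_num) hs'
  have i1 : IntegrableOn (fun x => ε ^ 2 * (Laplacian.laplacian (fun x => u s x - w s x) x *
      (u s x - w s x))) (box ℓ) :=
    integrableOn_box (continuous_const.mul ((continuous_laplacian cd).mul cd.continuous))
  have i2 : IntegrableOn (fun x => (u s x - w s x) ^ 2) (box ℓ) :=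
    integrableOn_box (cd.continuous.pow 2)
  calc _ ≤ ∫ x in box ℓ, (ε ^ 2 * (Laplacian.laplacian (fun x => u s x - w s x) x *
        (u s x - w s x)) + (u s x - w s x) ^ 2) := by
        refine integral_mono (integrableOn_box (cd.continuous.mul (c1.sub c2))) (i1.add i2)
          fun x => ?_
        have e1 := hu.equation s hs x
        have e2 := hw.equation s hs x
        have e3 := sub_mul_force_sub_le (u s x) (w s x)
        simp only [hlap]
        have e4 : timeDeriv T u 1 s x - timeDeriv T w 1 s x =
          ε ^ 2 * (Laplacian.laplacian (u s) x - Laplacian.laplacian (w s) x) -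
            (force (u s x) - force (w s x)) := by linarith
        rw [e4]
        linarith
    _ = ε ^ 2 * -dirichlet ℓ (fun x => u s x - w s x) (fun x => u s x - w s x) +
        ∫ x in box ℓ, (u s x - w s x) ^ 2 := by
        rw [integral_add i1 i2, integral_const_mul, green]
    _ ≤ _ := by nlinarith [mul_nonneg (sq_nonneg ε) hD]

/-- The squared L² distance y of the two solutions satisfies y(b) ≤ 2 ∫_0^b y by the energy
inequality, hence vanishes. This is what makes the constants depend on u₀ and not on u. -/
theorem IsSolution.eq_on_box (hT : 0 < T) (hℓ : ∀ i, 0 < ℓ i)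
    {w : ℝ → EuclideanSpace ℝ (Fin d) → ℝ}
    (hu : IsSolution ℓ ε T u₀ u) (hw : IsSolution ℓ ε T u₀ w) {s : ℝ} (hs : s ∈ Set.Icc 0 T)
    {x : EuclideanSpace ℝ (Fin d)} (hx : x ∈ box ℓ) : u s x = w s x := by
  set D : ℕ → ℝ → EuclideanSpace ℝ (Fin d) → ℝ := fun k s x =>
    timeDerivExt T hT.le u k s x - timeDerivExt T hT.le w k s x with hD
  have cD : ∀ k ≤ 4, Continuous (Function.uncurry (D k)) := fun k hk =>
    (hu.continuous_ext hT.le hk).sub (hw.continuous_ext hT.le hk)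
  have eD : ∀ k, ∀ s ∈ Set.Icc 0 T, ∀ x, D k s x = timeDeriv T u k s x - timeDeriv T w k s x :=
    fun k s hs x => by simp only [hD, timeDerivExt_of_mem hT.le k hs]
  have eD0 : ∀ s ∈ Set.Icc 0 T, ∀ x, D 0 s x = u s x - w s x :=
    fun s hs x => by rw [eD 0 s hs, timeDeriv_zero, timeDeriv_zero]
  set y : ℝ → ℝ := fun s => ∫ x in box ℓ, D 0 s x ^ 2 with hy
  have cy : Continuous y := continuous_integral_box (k := fun s x => D 0 s x ^ 2)
    ((cD 0 (by norm_num)).pow 2)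
  have c01 : Continuous (Function.uncurry fun s x => 2 * (D 0 s x * D 1 s x)) :=
    continuous_const.mul ((cD 0 (by norm_num)).mul (cD 1 (by norm_num)))
  have hle : ∀ b ∈ Set.Icc 0 T, y b ≤ 2 * ∫ s in (0 : ℝ)..b, y s := by
    intro b hb
    have ftc : ∀ x, D 0 b x ^ 2 = ∫ s in (0 : ℝ)..b, 2 * (D 0 s x * D 1 s x) := by
      intro x
      have hsub : ∀ z ∈ Set.Ioo 0 b, z ∈ Set.Icc 0 T := fun z hz => ⟨hz.1.le, hz.2.le.trans hb.2⟩
      have cx : ∀ k ≤ 4, Continuous fun s => D k s x := fun k hk =>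
        (cD k hk).comp (by fun_prop : Continuous fun s : ℝ => (s, x))
      have hint : IntervalIntegrable (fun s => 2 * (D 0 s x * D 1 s x)) volume 0 b :=
        (continuous_const.mul ((cx 0 (by norm_num)).mul
          (cx 1 (by norm_num)))).intervalIntegrable _ _
      rw [intervalIntegral.integral_eq_sub_of_hasDerivAt_of_le (f := fun s => D 0 s x ^ 2) hb.1
        ((cx 0 (by norm_num)).pow 2).continuousOn ?_ hint]
      · have h0 : (0 : ℝ) ∈ Set.Icc 0 T := ⟨le_rfl, hT.le⟩
        simp [eD0 0 h0, hu.initial, hw.initial]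
      · intro z hz
        have nh : Set.Icc 0 T ∈ nhds z := Icc_mem_nhds hz.1 (hz.2.trans_le hb.2)
        have du := ((hu.derivChain hT (m := 0) (by norm_num) x).deriv 0 le_rfl z
          (hsub z hz)).hasDerivAt nh
        have dw := ((hw.derivChain hT (m := 0) (by norm_num) x).deriv 0 le_rfl z
          (hsub z hz)).hasDerivAt nh
        have dD : HasDerivAt (fun s => D 0 s x) (D 1 z x) z := by
          rw [eD 1 z (hsub z hz)]
          refine (du.sub dw).congr_of_eventuallyEq ?_
          filter_upwards [nh] with q hq
          exact eD 0 q hq x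
        refine (dD.pow 2).congr_deriv ?_
        norm_num
        ring
    calc y b = ∫ x in box ℓ, ∫ s in (0 : ℝ)..b, 2 * (D 0 s x * D 1 s x) := by
          simp only [hy, ftc]
      _ = ∫ s in (0 : ℝ)..b, ∫ x in box ℓ, 2 * (D 0 s x * D 1 s x) :=
          (integral_box_swap c01 0 b).symm
      _ ≤ ∫ s in (0 : ℝ)..b, 2 * y s := by
          -- The comparison is restricted to interior times because the equation is assumed only for
          -- s > 0.
          refine intervalIntegral.integral_mono_on_of_le_Ioo hb.1
            ((continuous_integral_box c01).intervalIntegrable _ _)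
            ((continuous_const.mul cy).intervalIntegrable _ _) fun z hz => ?_
          have hz' : z ∈ Set.Ioc 0 T := ⟨hz.1, hz.2.le.trans hb.2⟩
          have hz'' := Set.Ioc_subset_Icc_self hz'
          rw [integral_const_mul]
          have := hu.integral_sub_mul_le hℓ hw hz'
          simp only [hy, eD0 z hz'', eD 1 z hz'']
          linarith
      _ = _ := intervalIntegral.integral_const_mul _ _
  have hys : y s = 0 := le_antisymm (nonpos_of_le_integral cy (by norm_num) hle hs)
    (integral_nonneg fun _ => sq_nonneg _)
  have cDs : Continuous (D 0 s) :=
    (cD 0 (by norm_num)).comp (by fun_prop : Continuous fun x => (s, x))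
  have hae := (integral_eq_zero_iff_of_nonneg (fun x => sq_nonneg (D 0 s x))
    (integrableOn_box (ℓ := ℓ) (cDs.pow 2))).1 hys
  have := Measure.eqOn_open_of_ae_eq hae (isOpen_box ℓ) (cDs.pow 2).continuousOn
    continuousOn_const hx
  rw [← sub_eq_zero, ← eD0 s hs]
  exact pow_eq_zero_iff (two_ne_zero) |>.1 this

/-- Bounds of a solution and of its time increments, depending on the initial value only. -/
theorem exists_solution_bounds (hT : 0 < T) (hℓ : ∀ i, 0 < ℓ i)
    (u₀ : EuclideanSpace ℝ (Fin d) → ℝ) :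
    ∃ M K : ℝ, 0 ≤ M ∧ 0 ≤ K ∧ ∀ u, IsSolution ℓ ε T u₀ u → ∀ x ∈ box ℓ,
      (∀ s ∈ Set.Icc 0 T, |u s x| ≤ M) ∧
      ∀ s ∈ Set.Icc 0 T, ∀ s' ∈ Set.Icc 0 T, |u s' x - u s x| ≤ K * |s' - s| := by
  -- Bounds of one solution w on the compact closed box serve all solutions by uniqueness; if there
  -- is none, any constants do.
  by_cases hex : ∃ w, IsSolution ℓ ε T u₀ w
  swap
  · exact ⟨0, 0, le_rfl, le_rfl, fun u hu => absurd ⟨u, hu⟩ hex⟩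
  obtain ⟨w, hw⟩ := hex
  have hbd : ∀ k ≤ 4, ∃ M, ∀ p ∈ Set.Icc 0 T ×ˢ closedBox ℓ, ‖timeDeriv T w k p.1 p.2‖ ≤ M :=
    fun k hk => (isCompact_Icc.prod (isCompact_closedBox ℓ)).exists_bound_of_continuousOn
      ((hw.timeDeriv_continuous k hk).mono (Set.prod_mono_right (Set.subset_univ _)))
  obtain ⟨M, hM⟩ := hbd 0 (by norm_num)
  obtain ⟨K, hK⟩ := hbd 1 (by norm_num)
  refine ⟨|M|, |K|, abs_nonneg _, abs_nonneg _, fun u hu x hx => ⟨fun s hs => ?_,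
    fun s hs s' hs' => ?_⟩⟩
  · rw [hu.eq_on_box hT hℓ hw hs hx, ← timeDeriv_zero (T := T) (u := w)]
    exact (hM (s, x) ⟨hs, box_subset_closedBox ℓ hx⟩).trans (le_abs_self M)
  · rw [hu.eq_on_box hT hℓ hw hs hx, hu.eq_on_box hT hℓ hw hs' hx,
      ← timeDeriv_zero (T := T) (u := w), ← timeDeriv_zero (T := T) (u := w)]
    exact (convex_Icc 0 T).norm_image_sub_le_of_norm_hasDerivWithin_le
      ((hw.derivChain hT (m := 0) (by norm_num) x).deriv 0 le_rfl)
      (fun z hz => (hK (z, x) ⟨hz, box_subset_closedBox ℓ hx⟩).trans (le_abs_self K)) hs hs'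

end

end

section

open MeasureTheory

variable {d : ℕ} {ℓ : Fin d → ℝ} {ε T : ℝ} {u₀ : EuclideanSpace ℝ (Fin d) → ℝ}
  {u : ℝ → EuclideanSpace ℝ (Fin d) → ℝ} {N : ℕ} {t : ℕ → ℝ}

/-! ### The truncation error in `L²(Ω)` -/

theorem IsGrid.mono (h : IsGrid T N t) {i j : ℕ} (hij : i ≤ j) (hj : j ≤ N) : t i ≤ t j := by
  induction j, hij using Nat.le_induction with
  | base => exact le_rfl
  | succ j _ ih => exact (ih (by omega)).trans (h.lt_succ j (by omega)).le

theorem IsGrid.mem_Icc (h : IsGrid T N t) {k : ℕ} (hk : k ≤ N) : t k ∈ Set.Icc 0 T :=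
  ⟨h.zero ▸ h.mono (Nat.zero_le k) hk, h.last ▸ h.mono hk le_rfl⟩

/-- The truncation error of the scheme at the time level `n`. -/
def truncation (T : ℝ) (t : ℕ → ℝ) (u : ℝ → EuclideanSpace ℝ (Fin d) → ℝ) (n : ℕ)
    (x : EuclideanSpace ℝ (Fin d)) : ℝ :=
  discreteDeriv t (fun k => u (t k) x) n - timeDeriv T u 1 (t n) x

/-- The pointwise integral of the modulus of a time derivative over the `j`-th time interval. -/
def pointMass (T : ℝ) (t : ℕ → ℝ) (u : ℝ → EuclideanSpace ℝ (Fin d) → ℝ) (k j : ℕ)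
    (x : EuclideanSpace ℝ (Fin d)) : ℝ :=
  ∫ s in t (j - 1)..t j, |timeDeriv T u k s x|

theorem pointMass_eq_ext (h : IsGrid T N t) (hT : 0 ≤ T) (k : ℕ) {j : ℕ} (hj : j ≤ N) :
    pointMass T t u k j = fun x => ∫ s in t (j - 1)..t j, |timeDerivExt T hT u k s x| := by
  funext x
  refine intervalIntegral.integral_congr fun s hs => ?_
  have hs' : s ∈ Set.Icc 0 T := Set.uIcc_subset_Icc (h.mem_Icc (by omega)) (h.mem_Icc hj) hs
  simp only [timeDerivExt_of_mem hT k hs']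

theorem IsSolution.continuous_pointMass (hu : IsSolution ℓ ε T u₀ u) (h : IsGrid T N t)
    (hT : 0 ≤ T) {k : ℕ} (hk : k ≤ 4) {j : ℕ} (hj : j ≤ N) : Continuous (pointMass T t u k j) := by
  rw [pointMass_eq_ext h hT k hj]
  exact continuous_time_integral (k := fun s x => |timeDerivExt T hT u k s x|)
    (continuous_abs.comp (hu.continuous_ext hT hk)) _ _

/-- Minkowski's inequality turns the pointwise Taylor bounds into the L² quantities of the theorem.
The extension by constants supplies the joint continuity on all of ℝ × ℝ^d that it requires. -/
theorem IsSolution.normL2_pointMass_le (hu : IsSolution ℓ ε T u₀ u) (h : IsGrid T N t)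
    (hT : 0 ≤ T) {k : ℕ} (hk : k ≤ 4) {j : ℕ} (hj : j ≤ N) :
    normL2 ℓ (pointMass T t u k j) ≤ derivMass ℓ T t u k j := by
  rw [pointMass_eq_ext h hT k hj]
  refine (normL2_integral_le (k := fun s x => |timeDerivExt T hT u k s x|)
    (continuous_abs.comp (hu.continuous_ext hT hk)) (h.mono (by omega) hj)).trans_eq ?_
  refine intervalIntegral.integral_congr fun s hs => ?_
  have hs' : s ∈ Set.Icc 0 T := Set.uIcc_subset_Icc (h.mem_Icc (by omega)) (h.mem_Icc hj) hs
  simp only [normL2_abs, timeDerivExt_of_mem hT k hs']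

theorem IsSolution.continuous_grid (hu : IsSolution ℓ ε T u₀ u) (h : IsGrid T N t) {k : ℕ}
    (hk : k ≤ N) : Continuous (u (t k)) :=
  (hu.space_smooth _ (h.mem_Icc hk)).continuous

theorem continuous_discreteDeriv {v : ℕ → EuclideanSpace ℝ (Fin d) → ℝ}
    (hv : ∀ k ≤ N, Continuous (v k)) {n : ℕ} (hn : n ≤ N) :
    Continuous fun x => discreteDeriv t (fun k => v k x) n := by
  refine continuous_finsetSum _ fun k hk => ?_
  have := (Finset.mem_Icc.1 hk).2
  exact continuous_const.mul ((hv k (by omega)).sub (hv (k - 1) (by omega)))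

theorem IsSolution.continuous_truncation (hu : IsSolution ℓ ε T u₀ u) (h : IsGrid T N t) {n : ℕ}
    (hn : n ≤ N) : Continuous (truncation T t u n) :=
  (continuous_discreteDeriv (v := fun k => u (t k)) (fun _ hk => hu.continuous_grid h hk) hn).sub
    (hu.continuous_timeDeriv (by norm_num) (h.mem_Icc hn))

theorem IsSolution.normL2_truncation_one (hu : IsSolution ℓ ε T u₀ u) (h : IsGrid T N t)
    (hT : 0 < T) (hN : 1 ≤ N) :
    normL2 ℓ (truncation T t u 1) ≤ 2 * derivMass ℓ T t u 2 1 := by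
  have hc := hu.continuous_pointMass h hT.le (k := 2) (by norm_num) hN
  refine (normL2_mono (hu.continuous_truncation h hN) (continuous_const.mul hc)
    (fun x => ?_)).trans ((normL2_const_mul (by norm_num) _).trans_le
      (mul_le_mul_of_nonneg_left (hu.normL2_pointMass_le h hT.le (by norm_num) hN) (by norm_num)))
  have e : t 0 + step t 1 = t 1 := by simp [step]
  have := bdf1_truncation (c := t 0) (h.step_pos le_rfl hN)
    ((hu.derivChain hT (m := 1) (by norm_num) x).mono (h.mem_Icc (Nat.zero_le N)).1
      (e ▸ (h.mem_Icc hN).2))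
  rw [e, timeDeriv_zero, timeDeriv_zero] at this
  have e' : truncation T t u 1 x = 1 / step t 1 * (u (t 1) x - u (t 0) x) -
      timeDeriv T u 1 (t 1) x := by
    rw [truncation, discreteDeriv_succ]
    simp [kernel]
  rw [e']
  exact this

theorem IsSolution.normL2_truncation_two (hu : IsSolution ℓ ε T u₀ u) (h : IsGrid T N t)
    (hT : 0 < T) (hN : 2 ≤ N) :
    normL2 ℓ (truncation T t u 2) ≤
      3 * (step t 2 * derivMass ℓ T t u 3 2 + step t 1 * derivMass ℓ T t u 3 1) := by
  have hN1 : 1 ≤ N := by omega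
  have hs2 := h.step_pos (by norm_num : 1 ≤ 2) hN
  have hs1 := h.step_pos le_rfl hN1
  have hc1 := hu.continuous_pointMass h hT.le (k := 3) (by norm_num) hN1
  have hc2 := hu.continuous_pointMass h hT.le (k := 3) (by norm_num) hN
  have hb1 := hu.normL2_pointMass_le h hT.le (k := 3) (by norm_num) hN1
  have hb2 := hu.normL2_pointMass_le h hT.le (k := 3) (by norm_num) hN
  calc normL2 ℓ (truncation T t u 2)
      ≤ normL2 ℓ (fun x => 3 * (step t 2 * pointMass T t u 3 2 x +
          step t 1 * pointMass T t u 3 1 x)) := by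
        refine normL2_mono (hu.continuous_truncation h hN) (by fun_prop) fun x => ?_
        have e : t 1 + step t 2 = t 2 := by simp [step]
        have e0 : t 1 - step t 1 = t 0 := by simp [step]
        have := bdf2_truncation (c := t 1) hs2 hs1
          ((hu.derivChain hT (m := 2) (by norm_num) x).mono
            (e0 ▸ (h.mem_Icc (Nat.zero_le N)).1) (e ▸ (h.mem_Icc hN).2))
        rw [e, e0, timeDeriv_zero, timeDeriv_zero, timeDeriv_zero] at this
        have e' : truncation T t u 2 x =
            (1 + 2 * (step t 2 / step t 1)) / (step t 2 * (1 + step t 2 / step t 1)) *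
              (u (t 2) x - u (t 1) x) +
            -((step t 2 / step t 1) ^ 2) / (step t 2 * (1 + step t 2 / step t 1)) *
              (u (t 1) x - u (t 0) x) - timeDeriv T u 1 (t 2) x := by
          rw [truncation, discreteDeriv_succ]
          simp [Finset.sum_range_succ, kernel, ratio]
          ring
        rw [e']
        exact this
    _ = 3 * normL2 ℓ (fun x => step t 2 * pointMass T t u 3 2 x +
          step t 1 * pointMass T t u 3 1 x) := normL2_const_mul (by norm_num) _
    _ ≤ 3 * (step t 2 * normL2 ℓ (pointMass T t u 3 2) +
          step t 1 * normL2 ℓ (pointMass T t u 3 1)) := by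
        rw [← normL2_const_mul hs2.le, ← normL2_const_mul hs1.le]
        exact mul_le_mul_of_nonneg_left (normL2_add_le (by fun_prop) (by fun_prop)) (by norm_num)
    _ ≤ _ := by gcongr

theorem IsSolution.normL2_truncation_add_three (hu : IsSolution ℓ ε T u₀ u) (h : IsGrid T N t)
    (hT : 0 < T) {n : ℕ} (hn : n + 3 ≤ N) (hr2 : ratio t (n + 2) ≤ 40)
    (hr3 : ratio t (n + 3) ≤ 40) :
    normL2 ℓ (truncation T t u (n + 3)) ≤
      10 ^ 12 * (step t (n + 3) ^ 2 * derivMass ℓ T t u 4 (n + 3) +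
        step t (n + 2) ^ 2 * derivMass ℓ T t u 4 (n + 2) +
        step t (n + 1) ^ 2 * derivMass ℓ T t u 4 (n + 1)) := by
  have hs3 := h.step_pos (by omega : 1 ≤ n + 3) hn
  have hs2 := h.step_pos (by omega : 1 ≤ n + 2) (by omega)
  have hs1 := h.step_pos (by omega : 1 ≤ n + 1) (by omega)
  have hc : ∀ j ≤ N, Continuous (pointMass T t u 4 j) := fun j hj =>
    hu.continuous_pointMass h hT.le (k := 4) le_rfl hj
  have hb : ∀ j ≤ N, normL2 ℓ (pointMass T t u 4 j) ≤ derivMass ℓ T t u 4 j := fun j hj =>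
    hu.normL2_pointMass_le h hT.le (k := 4) le_rfl hj
  have hc3 := hc _ hn
  have hc2 := hc (n + 2) (by omega)
  have hc1 := hc (n + 1) (by omega)
  have hb3 := hb _ hn
  have hb2 := hb (n + 2) (by omega)
  have hb1 := hb (n + 1) (by omega)
  calc normL2 ℓ (truncation T t u (n + 3))
      ≤ normL2 ℓ (fun x => 10 ^ 12 * ((step t (n + 3) ^ 2 * pointMass T t u 4 (n + 3) x +
          step t (n + 2) ^ 2 * pointMass T t u 4 (n + 2) x) +
          step t (n + 1) ^ 2 * pointMass T t u 4 (n + 1) x)) := by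
        refine normL2_mono (hu.continuous_truncation h hn) (by fun_prop) fun x => ?_
        have e3 : t (n + 2) + step t (n + 3) = t (n + 3) := by simp [step]
        have e2 : t (n + 2) - step t (n + 2) = t (n + 1) := by simp [step]
        have e1 : t (n + 2) - (step t (n + 2) + step t (n + 1)) = t n := by simp [step]
        have := bdf3_truncation (c := t (n + 2)) hs3 hs2 hs1 ((div_le_iff₀ hs2).1 hr3)
          ((div_le_iff₀ hs1).1 hr2) ((hu.derivChain hT (m := 3) (by norm_num) x).mono
            (e1 ▸ (h.mem_Icc (by omega)).1) (e3 ▸ (h.mem_Icc hn).2))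
        rw [e3, e2, e1, timeDeriv_zero, timeDeriv_zero, timeDeriv_zero, timeDeriv_zero] at this
        have e' : truncation T t u (n + 3) x =
            kernel3 (step t (n + 3)) (step t (n + 3) / step t (n + 2))
              (step t (n + 2) / step t (n + 1)) 0 * (u (t (n + 3)) x - u (t (n + 2)) x) +
            kernel3 (step t (n + 3)) (step t (n + 3) / step t (n + 2))
              (step t (n + 2) / step t (n + 1)) 1 * (u (t (n + 2)) x - u (t (n + 1)) x) +
            kernel3 (step t (n + 3)) (step t (n + 3) / step t (n + 2))
              (step t (n + 2) / step t (n + 1)) 2 * (u (t (n + 1)) x - u (t n) x) -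
            timeDeriv T u 1 (t (n + 3)) x := by
          rw [truncation, discreteDeriv_succ,
            sum_kernel_add_three t n fun k => u (t (k + 1)) x - u (t k) x]
          rfl
        rw [e']
        exact this
    _ = 10 ^ 12 * normL2 ℓ (fun x => (step t (n + 3) ^ 2 * pointMass T t u 4 (n + 3) x +
          step t (n + 2) ^ 2 * pointMass T t u 4 (n + 2) x) +
          step t (n + 1) ^ 2 * pointMass T t u 4 (n + 1) x) := normL2_const_mul (by norm_num) _
    _ ≤ 10 ^ 12 * ((step t (n + 3) ^ 2 * normL2 ℓ (pointMass T t u 4 (n + 3)) +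
          step t (n + 2) ^ 2 * normL2 ℓ (pointMass T t u 4 (n + 2))) +
          step t (n + 1) ^ 2 * normL2 ℓ (pointMass T t u 4 (n + 1))) := by
        rw [← normL2_const_mul (sq_nonneg (step t (n + 3))),
          ← normL2_const_mul (sq_nonneg (step t (n + 2))),
          ← normL2_const_mul (sq_nonneg (step t (n + 1)))]
        refine mul_le_mul_of_nonneg_left ((normL2_add_le (by fun_prop) (by fun_prop)).trans ?_)
          (by norm_num)
        exact add_le_add_left (normL2_add_le (by fun_prop) (by fun_prop)) _
    _ ≤ _ := by gcongr

/-! ### The energy estimate -/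

/-- The relative potential energy `(w - e)⁴/4 - w⁴/4 + w³ e` of the perturbation `w - e` of `w`. -/
def relPotential (w e : ℝ) : ℝ := 3 / 2 * w ^ 2 * e ^ 2 - w * e ^ 3 + e ^ 4 / 4

/-- The difference is 2 e² (e - 3w)². Coercivity uniform in w lets the potential control cubic
powers of the error. -/
theorem pow_four_le_relPotential (w e : ℝ) : e ^ 4 ≤ 12 * relPotential w e := by
  have : 12 * relPotential w e - e ^ 4 = 2 * (e * (e - 3 * w)) ^ 2 := by
    unfold relPotential; ring
  nlinarith [sq_nonneg (e * (e - 3 * w))]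

theorem relPotential_nonneg (w e : ℝ) : 0 ≤ relPotential w e := by
  have := pow_four_le_relPotential w e
  have : 0 ≤ e ^ 4 := by positivity
  linarith

/-- Convexity in e: w³ - (w - e)³ is the derivative of the potential, so this is the tangent-line
inequality at e. -/
theorem relPotential_sub_le (w e e' : ℝ) :
    relPotential w e - relPotential w e' ≤ (w ^ 3 - (w - e) ^ 3) * (e - e') := by
  have : (w ^ 3 - (w - e) ^ 3) * (e - e') - (relPotential w e - relPotential w e') =
      (e - e') ^ 2 * (((w - e') + (w - e)) ^ 2 + 2 * (w - e) ^ 2) / 4 := by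
    unfold relPotential; ring
  have h : 0 ≤ (e - e') ^ 2 * (((w - e') + (w - e)) ^ 2 + 2 * (w - e) ^ 2) / 4 := by positivity
  linarith

/-- The cost of moving the base point from u(t_{n-1}) to u(t_n). The cubic term obeys |e|³ ≤ (e² +
e⁴)/2, and e⁴ is returned to the potential. -/
theorem relPotential_sub_left_le {w w' e M B : ℝ} (hw : |w| ≤ M) (hw' : |w'| ≤ M)
    (hB : |w - w'| ≤ B) :
    relPotential w e - relPotential w' e ≤ B * ((3 * M + 1 / 2) * e ^ 2 + 6 * relPotential w' e) := by
  have e1 : relPotential w e - relPotential w' e =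
      (w - w') * (3 / 2 * (w + w') * e ^ 2 - e ^ 3) := by
    unfold relPotential; ring
  have h1 : |3 / 2 * (w + w') * e ^ 2 - e ^ 3| ≤
      (3 * M + 1 / 2) * e ^ 2 + 6 * relPotential w' e := by
    have h2 := pow_four_le_relPotential w' e
    have h3 : 3 / 2 * |w + w'| * e ^ 2 ≤ 3 * M * e ^ 2 := by
      have := abs_add_le w w'
      have := mul_le_mul_of_nonneg_right (this.trans (add_le_add hw hw')) (sq_nonneg e)
      linarith
    have h4 : |e ^ 3| ≤ 1 / 2 * e ^ 2 + 1 / 2 * e ^ 4 :=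
      abs_le.2 ⟨by nlinarith [sq_nonneg (e * (e + 1))], by nlinarith [sq_nonneg (e * (e - 1))]⟩
    refine (abs_sub _ _).trans ?_
    rw [abs_mul, abs_mul, abs_of_pos (by norm_num : (0 : ℝ) < 3 / 2), abs_of_nonneg (sq_nonneg e)]
    linarith
  rw [e1]
  refine (le_abs_self _).trans ?_
  rw [abs_mul]
  gcongr
  exact (abs_nonneg _).trans hB

/-- The energy inequality of one time step, at a point of space. -/
theorem step_energy {c τ ξ A w w' e e' M K : ℝ} (hc : 0 < c) (hτ : 0 < τ) (hw : |w| ≤ M)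
    (hw' : |w'| ≤ M) (hK : |w - w'| ≤ K * τ) :
    (e - e') * (ξ + A - (w ^ 3 - (w - e) ^ 3) + e) - c / τ * (e - e') ^ 2 +
        ((relPotential w e + e ^ 2) - (relPotential w' e' + e' ^ 2)) ≤
      A * (e - e') + (τ * (ξ ^ 2 / c) + τ * (3 / c * e ^ 2) +
        τ * (K * ((3 * M + 1 / 2) * e' ^ 2 + 6 * relPotential w' e'))) := by
  have h1 := relPotential_sub_le w e e'
  have h2 := relPotential_sub_left_le (e := e') hw hw' hK
  -- The dissipation is spent in quarters: one on ξ, one on the linear term e, and two on the growth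
  -- of the added e², since e² - e'² ≤ 2 (e - e') e.
  have young : ∀ a b : ℝ, a * b ≤ c / τ * a ^ 2 / 4 + τ * (b ^ 2 / c) := by
    intro a b
    have : c / τ * a ^ 2 / 4 + τ * (b ^ 2 / c) - a * b =
        (c * a / 2 - τ * b) ^ 2 / (c * τ) := by field_simp; ring
    have h : 0 ≤ (c * a / 2 - τ * b) ^ 2 / (c * τ) := by positivity
    linarith
  have h3 := young (e - e') ξ
  have h4 := young (e - e') e
  have h5 : τ * (3 / c * e ^ 2) = 3 * (τ * (e ^ 2 / c)) := by ring
  have h6 : e ^ 2 - e' ^ 2 ≤ 2 * ((e - e') * e) := by nlinarith [sq_nonneg (e - e')]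
  nlinarith

end

/-! ### Error equation, summed energy inequality and stability. -/

section

open MeasureTheory

variable {d : ℕ} {ℓ : Fin d → ℝ} {ε T : ℝ} {u₀ : EuclideanSpace ℝ (Fin d) → ℝ}
  {u : ℝ → EuclideanSpace ℝ (Fin d) → ℝ} {N : ℕ} {t : ℕ → ℝ}
  {v : ℕ → EuclideanSpace ℝ (Fin d) → ℝ}

/-- A discrete Grönwall inequality with the current value on the right-hand side. -/
theorem discrete_gronwall {P τ : ℕ → ℝ} {A L : ℝ} (hA : 0 ≤ A) (hL : 0 ≤ L) {n : ℕ}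
    (hτ : ∀ k < n, 0 ≤ τ k) (hLτ : ∀ k < n, L * τ k ≤ 1 / 2)
    (h : ∀ m ≤ n, P m ≤ A + ∑ k ∈ Finset.range m, L * τ k * (P (k + 1) + P k)) :
    P n ≤ A * Real.exp (4 * L * ∑ k ∈ Finset.range n, τ k) := by
  have key : ∀ m ≤ n, A + ∑ k ∈ Finset.range m, L * τ k * (P (k + 1) + P k) ≤
      A * Real.exp (4 * L * ∑ k ∈ Finset.range m, τ k) := by
    intro m
    induction m with
    | zero => intro _; simp
    | succ m ih =>
      intro hm
      have ih := ih (by omega)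
      have h1 := h (m + 1) hm
      have h0 := h m (by omega)
      have ha0 : 0 ≤ L * τ m := mul_nonneg hL (hτ m hm)
      have ha := hLτ m hm
      rw [Finset.sum_range_succ] at h1 ⊢
      rw [Finset.sum_range_succ, mul_add (4 * L), Real.exp_add, ← mul_assoc A]
      set S := ∑ k ∈ Finset.range m, L * τ k * (P (k + 1) + P k)
      set E := A * Real.exp (4 * L * ∑ k ∈ Finset.range m, τ k)
      have hE : 0 ≤ E := mul_nonneg hA (Real.exp_pos _).le
      have hexp : 1 + 4 * (L * τ m) ≤ Real.exp (4 * L * τ m) := by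
        have := Real.add_one_le_exp (4 * L * τ m)
        linarith
      refine le_trans ?_ (mul_le_mul_of_nonneg_left hexp hE)
      generalize L * τ m = a at *
      have h2 : (A + (S + a * (P (m + 1) + P m))) * (1 - a) ≤ E * (1 + a) := by
        nlinarith [mul_le_mul_of_nonneg_left h1 ha0, mul_le_mul_of_nonneg_left h0 ha0,
          mul_le_mul_of_nonneg_left ih ha0]
      -- For 0 ≤ a ≤ 1/2 one has (1 + a)/(1 - a) ≤ 1 + 4a ≤ exp(4a), whence the factor 4 in the
      -- exponent.
      have h3 : E * (1 + a) ≤ E * (1 + 4 * a) * (1 - a) := by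
        nlinarith [mul_nonneg hE (mul_nonneg ha0 (by linarith : 0 ≤ 1 - 2 * a))]
      exact le_of_mul_le_mul_right (h2.trans h3) (by linarith)
  exact (h n le_rfl).trans (key n le_rfl)

/-- The error equation. -/
theorem discreteDeriv_error (h : IsGrid T N t) (hu : IsSolution ℓ ε T u₀ u)
    (hv : IsDiscreteSolution ℓ ε u₀ N t v) {n : ℕ} (hn1 : 1 ≤ n) (hn : n ≤ N)
    (x : EuclideanSpace ℝ (Fin d)) :
    discreteDeriv t (fun k => u (t k) x - v k x) n =
      truncation T t u n x + ε ^ 2 * Laplacian.laplacian (fun x => u (t n) x - v n x) x -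
        (u (t n) x ^ 3 - (u (t n) x - (u (t n) x - v n x)) ^ 3) + (u (t n) x - v n x) := by
  have hpos : 0 < t n := by
    have := h.lt_succ 0 (by omega)
    rw [h.zero] at this
    exact this.trans_le (h.mono hn1 hn)
  have e1 := hu.equation (t n) ⟨hpos, (h.mem_Icc hn).2⟩ x
  have e2 := hv.equation n hn1 hn x
  have e3 : Laplacian.laplacian (fun x => u (t n) x - v n x) x =
      Laplacian.laplacian (u (t n)) x - Laplacian.laplacian (v n) x :=
    ContDiffAt.laplacian_sub ((hu.space_smooth _ (h.mem_Icc hn)).contDiffAt (x := x))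
      ((hv.space_smooth n hn).contDiffAt (x := x))
  rw [discreteDeriv_sub t (fun k => u (t k) x) (fun k => v k x), e3, truncation]
  unfold force at e1 e2
  linear_combination e1 - e2

/-- The energy of the error: relative potential energy, mass and Dirichlet energy. -/
def errorEnergy (ℓ : Fin d → ℝ) (ε : ℝ) (w e : EuclideanSpace ℝ (Fin d) → ℝ) : ℝ :=
  (∫ x in box ℓ, (relPotential (w x) (e x) + e x ^ 2)) + ε ^ 2 / 2 * dirichlet ℓ e e

theorem continuous_relPotential {w e : EuclideanSpace ℝ (Fin d) → ℝ} (hw : Continuous w)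
    (he : Continuous e) : Continuous fun x => relPotential (w x) (e x) := by
  unfold relPotential; fun_prop

theorem integral_relPotential_le_errorEnergy {w e : EuclideanSpace ℝ (Fin d) → ℝ}
    (hw : Continuous w) (he : Continuous e) :
    (∫ x in box ℓ, relPotential (w x) (e x)) + normL2 ℓ e ^ 2 ≤ errorEnergy ℓ ε w e := by
  have i2 : IntegrableOn (fun x => e x ^ 2) (box ℓ) := integrableOn_box (he.pow 2)
  rw [errorEnergy, integral_add (integrableOn_box (continuous_relPotential hw he)) i2, normL2_sq]
  have := dirichlet_self_nonneg (ℓ := ℓ) e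
  have : 0 ≤ ε ^ 2 / 2 * dirichlet ℓ e e := by positivity
  linarith

/-- The energy of the error is bounded by its history and the truncation errors. -/
theorem errorEnergy_le (hℓ : ∀ i, 0 < ℓ i) (h : IsGrid T N t)
    (hu : IsSolution ℓ ε T u₀ u) (hv : IsDiscreteSolution ℓ ε u₀ N t v) {c : ℝ} (hc : 0 < c)
    (hB : MatrixGT (kernelMatrix t N) (c • (stepMatrix t N)⁻¹)) {M K : ℝ} (hM0 : 0 ≤ M)
    (hK0 : 0 ≤ K)
    (hM : ∀ x ∈ box ℓ, ∀ s ∈ Set.Icc 0 T, |u s x| ≤ M)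
    (hK : ∀ x ∈ box ℓ, ∀ s ∈ Set.Icc 0 T, ∀ s' ∈ Set.Icc 0 T, |u s' x - u s x| ≤ K * |s' - s|)
    {n : ℕ} (hn : n ≤ N) :
    errorEnergy ℓ ε (u (t n)) (fun x => u (t n) x - v n x) ≤
      (∑ k ∈ Finset.range n, step t (k + 1) * normL2 ℓ (truncation T t u (k + 1)) ^ 2) / c +
      ∑ k ∈ Finset.range n, (3 / c + K * (3 * M + 7)) * step t (k + 1) *
        (errorEnergy ℓ ε (u (t (k + 1))) (fun x => u (t (k + 1)) x - v (k + 1) x) +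
          errorEnergy ℓ ε (u (t k)) (fun x => u (t k) x - v k x)) := by
  have hpos : ∀ k < N, 0 < step t (k + 1) := fun k hk => h.step_pos (by omega) hk
  set e : ℕ → EuclideanSpace ℝ (Fin d) → ℝ := fun k x => u (t k) x - v k x with he
  set R : ℕ → EuclideanSpace ℝ (Fin d) → ℝ := fun k x =>
    step t (k + 1) * (truncation T t u (k + 1) x ^ 2 / c) +
      step t (k + 1) * (3 / c * e (k + 1) x ^ 2) +
      step t (k + 1) * (K * ((3 * M + 1 / 2) * e k x ^ 2 +
        6 * relPotential (u (t k) x) (e k x))) with hR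
  have smooth : ∀ k ≤ N, ContDiff ℝ 2 (e k) := fun k hk =>
    (hu.space_smooth _ (h.mem_Icc hk)).sub (hv.space_smooth k hk)
  have per : ∀ k ≤ N, IsPeriodic ℓ (e k) := fun k hk =>
    (hu.periodic _ (h.mem_Icc hk)).sub (hv.periodic k hk)
  have cu : ∀ k ≤ N, Continuous (u (t k)) := fun k hk => hu.continuous_grid h hk
  have ce : ∀ k ≤ N, Continuous (e k) := fun k hk => (smooth k hk).continuous
  have cG : ∀ k ≤ N, Continuous fun x => relPotential (u (t k) x) (e k x) := fun k hk =>
    continuous_relPotential (cu k hk) (ce k hk)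
  have cξ : ∀ k < N, Continuous (truncation T t u (k + 1)) := fun k hk =>
    hu.continuous_truncation h hk
  have e00 : e 0 = fun _ => 0 := by
    funext x
    simp only [he, h.zero, hu.initial, hv.initial, sub_self]
  -- Definiteness of B is applied at each fixed x to the scalar sequence of increments; integration
  -- over the box comes afterwards.
  have hpt : ∀ x ∈ box ℓ, relPotential (u (t n) x) (e n x) + e n x ^ 2 ≤
      ∑ k ∈ Finset.range n, (ε ^ 2 * (Laplacian.laplacian (e (k + 1)) x *
        (e (k + 1) x - e k x)) + R k x) := by
    intro x hx
    have h1 := hB.sum_le hpos (fun k => e (k + 1) x - e k x) hn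
    have h2 : ∀ k ∈ Finset.range n,
        (e (k + 1) x - e k x) * ∑ j ∈ Finset.range (k + 1), kernel t (k + 1) (k - j) *
            (e (j + 1) x - e j x) -
          c / step t (k + 1) * (e (k + 1) x - e k x) ^ 2 +
          ((relPotential (u (t (k + 1)) x) (e (k + 1) x) + e (k + 1) x ^ 2) -
            (relPotential (u (t k) x) (e k x) + e k x ^ 2)) ≤
        ε ^ 2 * (Laplacian.laplacian (e (k + 1)) x * (e (k + 1) x - e k x)) + R k x := by
      intro k hk
      have hkN : k < N := (Finset.mem_range.1 hk).trans_le hn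
      rw [← discreteDeriv_succ t (fun j => e j x),
        discreteDeriv_error h hu hv (by omega) (by omega : k + 1 ≤ N)]
      have hstep : |u (t (k + 1)) x - u (t k) x| ≤ K * step t (k + 1) := by
        have := hK x hx (t k) (h.mem_Icc hkN.le) (t (k + 1)) (h.mem_Icc hkN)
        rwa [abs_of_pos (sub_pos.2 (h.lt_succ k hkN))] at this
      have := step_energy (ξ := truncation T t u (k + 1) x)
        (A := ε ^ 2 * Laplacian.laplacian (e (k + 1)) x) (e := e (k + 1) x) (e' := e k x)
        hc (hpos k hkN) (hM x hx _ (h.mem_Icc (by omega : k + 1 ≤ N)))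
        (hM x hx _ (h.mem_Icc hkN.le)) hstep
      refine this.trans_eq ?_
      simp only [hR]
      ring
    have h3 := Finset.sum_le_sum h2
    rw [Finset.sum_add_distrib, Finset.sum_sub_distrib, Finset.sum_range_sub
      (fun k => relPotential (u (t k) x) (e k x) + e k x ^ 2)] at h3
    have h0 : relPotential (u (t 0) x) (e 0 x) + e 0 x ^ 2 = 0 := by
      simp [e00, relPotential]
    rw [h0, sub_zero] at h3
    linarith
  have cR : ∀ k < N, Continuous (R k) := fun k hk => by
    have c1 := cξ k hk
    have c2 := ce (k + 1) hk
    have c3 := ce k hk.le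
    have c4 := cG k hk.le
    simp only [hR]
    fun_prop
  have iR : ∀ k < N, IntegrableOn (R k) (box ℓ) := fun k hk => integrableOn_box (cR k hk)
  have iL : ∀ k < N, IntegrableOn (fun x => ε ^ 2 * (Laplacian.laplacian (e (k + 1)) x *
        (e (k + 1) x - e k x))) (box ℓ) := fun k hk =>
    integrableOn_box (continuous_const.mul ((continuous_laplacian (smooth (k + 1) hk)).mul
      ((ce _ hk).sub (ce _ hk.le))))
  have hint : ∫ x in box ℓ, (relPotential (u (t n) x) (e n x) + e n x ^ 2) ≤
      ∑ k ∈ Finset.range n, (-(ε ^ 2 * dirichlet ℓ (e (k + 1)) (fun x => e (k + 1) x - e k x)) +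
        ∫ x in box ℓ, R k x) := by
    have iS : ∀ k ∈ Finset.range n, IntegrableOn (fun x => ε ^ 2 *
        (Laplacian.laplacian (e (k + 1)) x * (e (k + 1) x - e k x)) + R k x) (box ℓ) :=
      fun k hk => by
        have hkN : k < N := (Finset.mem_range.1 hk).trans_le hn
        exact (iL k hkN).add (iR k hkN)
    refine (setIntegral_mono_on (integrableOn_box ((cG n hn).add ((ce n hn).pow 2)))
      (integrable_finsetSum _ iS) (isOpen_box ℓ).measurableSet hpt).trans_eq ?_
    rw [integral_finsetSum _ iS]
    refine Finset.sum_congr rfl fun k hk => ?_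
    have hkN : k < N := (Finset.mem_range.1 hk).trans_le hn
    rw [integral_add (iL k hkN) (iR k hkN), integral_const_mul,
      integral_laplacian_mul hℓ (smooth (k + 1) hkN)
        (((smooth _ hkN).sub (smooth _ hkN.le)).of_le (by norm_num)) (per _ hkN)
        ((per _ hkN).sub (per _ hkN.le))]
    ring
  -- Convexity of the Dirichlet form makes the diffusion term telescope into the gradient part of
  -- `errorEnergy`.
  have hdir : ∀ k < N, -(ε ^ 2 * dirichlet ℓ (e (k + 1)) (fun x => e (k + 1) x - e k x)) ≤
      -(ε ^ 2 / 2 * dirichlet ℓ (e (k + 1)) (e (k + 1)) - ε ^ 2 / 2 * dirichlet ℓ (e k) (e k)) := by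
    intro k hk
    have := dirichlet_sub_le (ℓ := ℓ) ((smooth (k + 1) hk).of_le (by norm_num))
      ((smooth k hk.le).of_le (by norm_num))
    nlinarith [mul_le_mul_of_nonneg_left this (sq_nonneg ε)]
  have hRint : ∀ k < N, ∫ x in box ℓ, R k x ≤
      step t (k + 1) * normL2 ℓ (truncation T t u (k + 1)) ^ 2 / c +
      (3 / c + K * (3 * M + 7)) * step t (k + 1) *
        (errorEnergy ℓ ε (u (t (k + 1))) (e (k + 1)) + errorEnergy ℓ ε (u (t k)) (e k)) := by
    intro k hk
    have c1 := cξ k hk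
    have c2 := ce (k + 1) hk
    have c3 := ce k hk.le
    have c4 := cG k hk.le
    have heq : ∫ x in box ℓ, R k x =
        step t (k + 1) * (normL2 ℓ (truncation T t u (k + 1)) ^ 2 / c) +
        step t (k + 1) * (3 / c * normL2 ℓ (e (k + 1)) ^ 2) +
        step t (k + 1) * (K * ((3 * M + 1 / 2) * normL2 ℓ (e k) ^ 2 +
          6 * ∫ x in box ℓ, relPotential (u (t k) x) (e k x))) := by
      simp only [hR]
      rw [integral_add (integrableOn_box (by fun_prop)) (integrableOn_box (by fun_prop)),
        integral_add (integrableOn_box (by fun_prop)) (integrableOn_box (by fun_prop)),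
        integral_const_mul, integral_const_mul, integral_const_mul, integral_const_mul,
        integral_const_mul, integral_div, integral_add (integrableOn_box (by fun_prop))
          (integrableOn_box (by fun_prop)), integral_const_mul, integral_const_mul,
        normL2_sq, normL2_sq, normL2_sq]
    have b1 := integral_relPotential_le_errorEnergy (ℓ := ℓ) (ε := ε) (cu (k + 1) hk) c2
    have b0 := integral_relPotential_le_errorEnergy (ℓ := ℓ) (ε := ε) (cu k hk.le) c3
    have g1 : 0 ≤ ∫ x in box ℓ, relPotential (u (t (k + 1)) x) (e (k + 1) x) :=
      integral_nonneg fun _ => relPotential_nonneg _ _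
    have g0 : 0 ≤ ∫ x in box ℓ, relPotential (u (t k) x) (e k x) :=
      integral_nonneg fun _ => relPotential_nonneg _ _
    have n1 := sq_nonneg (normL2 ℓ (e (k + 1)))
    have n0 := sq_nonneg (normL2 ℓ (e k))
    have hs := (hpos k hk).le
    rw [heq]
    generalize errorEnergy ℓ ε (u (t (k + 1))) (e (k + 1)) = E1 at *
    generalize errorEnergy ℓ ε (u (t k)) (e k) = E0 at *
    generalize (∫ x in box ℓ, relPotential (u (t (k + 1)) x) (e (k + 1) x)) = G1 at *
    generalize (∫ x in box ℓ, relPotential (u (t k) x) (e k x)) = G0 at *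
    generalize normL2 ℓ (e (k + 1)) ^ 2 = m1 at *
    generalize normL2 ℓ (e k) ^ 2 = m0 at *
    have hc3 : 0 ≤ 3 / c := by positivity
    have q1 : 3 / c * m1 ≤ 3 / c * (E1 + E0) := by gcongr; linarith
    have q2 : (3 * M + 1 / 2) * m0 + 6 * G0 ≤ (3 * M + 7) * (E1 + E0) := by
      nlinarith [mul_nonneg hM0 g0, mul_nonneg hM0 (by linarith : 0 ≤ E1),
        mul_le_mul_of_nonneg_left b0 hM0]
    have q3 := mul_le_mul_of_nonneg_left (add_le_add q1 (mul_le_mul_of_nonneg_left q2 hK0)) hs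
    have q4 : step t (k + 1) * (normL2 ℓ (truncation T t u (k + 1)) ^ 2 / c) =
      step t (k + 1) * normL2 ℓ (truncation T t u (k + 1)) ^ 2 / c := by ring
    rw [q4]
    linarith
  have htot := hint.trans (Finset.sum_le_sum fun k hk =>
    add_le_add (hdir k ((Finset.mem_range.1 hk).trans_le hn))
      (hRint k ((Finset.mem_range.1 hk).trans_le hn)))
  have hd0 : dirichlet ℓ (e 0) (e 0) = 0 := by
    rw [e00]; simp [dirichlet]
  rw [Finset.sum_add_distrib, Finset.sum_add_distrib, Finset.sum_neg_distrib,
    Finset.sum_range_sub (fun k => ε ^ 2 / 2 * dirichlet ℓ (e k) (e k)), hd0,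
    ← Finset.sum_div] at htot
  rw [errorEnergy]
  linarith

theorem sum_step (t : ℕ → ℝ) (n : ℕ) : ∑ k ∈ Finset.range n, step t (k + 1) = t n - t 0 := by
  rw [← Finset.sum_range_sub]
  rfl

/-- Stability: the error is bounded by the truncation errors. -/
theorem normL2_error_sq_le (hℓ : ∀ i, 0 < ℓ i) (h : IsGrid T N t)
    (hu : IsSolution ℓ ε T u₀ u) (hv : IsDiscreteSolution ℓ ε u₀ N t v) {c : ℝ} (hc : 0 < c)
    (hB : MatrixGT (kernelMatrix t N) (c • (stepMatrix t N)⁻¹)) {M K : ℝ} (hM0 : 0 ≤ M)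
    (hK0 : 0 ≤ K)
    (hM : ∀ x ∈ box ℓ, ∀ s ∈ Set.Icc 0 T, |u s x| ≤ M)
    (hK : ∀ x ∈ box ℓ, ∀ s ∈ Set.Icc 0 T, ∀ s' ∈ Set.Icc 0 T, |u s' x - u s x| ≤ K * |s' - s|)
    (hstep : ∀ k, 1 ≤ k → k ≤ N → (3 / c + K * (3 * M + 7)) * step t k ≤ 1 / 2)
    {n : ℕ} (hn : n ≤ N) :
    normL2 ℓ (fun x => u (t n) x - v n x) ^ 2 ≤
      (∑ k ∈ Finset.range n, step t (k + 1) * normL2 ℓ (truncation T t u (k + 1)) ^ 2) / c *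
        Real.exp (4 * (3 / c + K * (3 * M + 7)) * T) := by
  have hpos : ∀ k < N, 0 < step t (k + 1) := fun k hk => h.step_pos (by omega) hk
  have hL : 0 ≤ 3 / c + K * (3 * M + 7) := by positivity
  have hterm : ∀ k < N, 0 ≤ step t (k + 1) * normL2 ℓ (truncation T t u (k + 1)) ^ 2 :=
    fun k hk => mul_nonneg (hpos k hk).le (sq_nonneg _)
  have hA : 0 ≤ (∑ k ∈ Finset.range n,
      step t (k + 1) * normL2 ℓ (truncation T t u (k + 1)) ^ 2) / c :=
    div_nonneg (Finset.sum_nonneg fun k hk =>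
      hterm k ((Finset.mem_range.1 hk).trans_le hn)) hc.le
  have hg := discrete_gronwall (P := fun k => errorEnergy ℓ ε (u (t k)) fun x => u (t k) x - v k x)
    (τ := fun k => step t (k + 1)) (n := n) hA hL
    (fun k hk => (hpos k (hk.trans_le hn)).le)
    (fun k hk => hstep (k + 1) (by omega) (by omega)) fun m hm => by
      refine (errorEnergy_le hℓ h hu hv hc hB hM0 hK0 hM hK (hm.trans hn)).trans ?_
      gcongr
      exact fun k hk _ => hterm k ((Finset.mem_range.1 hk).trans_le hn)
  have hcu := hu.continuous_grid h hn
  have he := integral_relPotential_le_errorEnergy (ℓ := ℓ) (ε := ε) hcu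
    (hcu.sub (hv.space_smooth n hn).continuous)
  have g0 : 0 ≤ ∫ x in box ℓ, relPotential (u (t n) x) (u (t n) x - v n x) :=
    integral_nonneg fun _ => relPotential_nonneg _ _
  have h1 : normL2 ℓ (fun x => u (t n) x - v n x) ^ 2 ≤
      errorEnergy ℓ ε (u (t n)) fun x => u (t n) x - v n x := by
    refine le_trans ?_ he
    exact le_add_of_nonneg_left g0
  refine h1.trans (hg.trans ?_)
  rw [sum_step, h.zero, sub_zero]
  gcongr
  exact (h.mem_Icc hn).2

end

section

open MeasureTheory

variable {d : ℕ} {ℓ : Fin d → ℝ} {ε T : ℝ} {u₀ : EuclideanSpace ℝ (Fin d) → ℝ}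
  {u : ℝ → EuclideanSpace ℝ (Fin d) → ℝ} {N : ℕ} {t : ℕ → ℝ}

/-! ### Convergence -/

theorem derivMass_nonneg (h : IsGrid T N t) (k : ℕ) {j : ℕ} (hj : j ≤ N) :
    0 ≤ derivMass ℓ T t u k j :=
  intervalIntegral.integral_nonneg (h.mono (by omega) hj) fun _ _ => normL2_nonneg _

theorem sum_Icc_three (f : ℕ → ℝ) (m : ℕ) :
    ∑ k ∈ Finset.Icc 3 (m + 2), f k = ∑ k ∈ Finset.range m, f (k + 3) := by
  rw [Finset.range_eq_Ico, Finset.sum_Ico_add' f 0 m 3]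
  rfl

theorem startTerms_nonneg (h : IsGrid T N t) {n : ℕ} (hn1 : 1 ≤ n) (hn : n ≤ N) :
    0 ≤ startTerms ℓ T t u n := by
  have hs1 := h.step_pos le_rfl (hn1.trans hn)
  have d1 := derivMass_nonneg (ℓ := ℓ) (u := u) h 2 (hn1.trans hn)
  rw [startTerms]
  refine add_nonneg (by positivity) ?_
  split_ifs with h2
  · have hs2 := h.step_pos (by norm_num : 1 ≤ 2) (h2.trans hn)
    have d2 := derivMass_nonneg (ℓ := ℓ) (u := u) h 3 (h2.trans hn)
    have d3 := derivMass_nonneg (ℓ := ℓ) (u := u) h 3 (hn1.trans hn)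
    positivity
  · exact le_rfl

/-- The factor τ_k becomes √τ_k inside the square, which explains the powers τ_1^{1/2}, τ_2^{3/2}
and τ_1 τ_2^{1/2} of the starting terms. A sum of squares of nonnegative terms is at most the square
of their sum, and 10^12 dominates the constants 2 and 3 of the starting steps. -/
theorem sum_truncation_le (hT : 0 < T) (h : IsGrid T N t) (hu : IsSolution ℓ ε T u₀ u)
    (hr : ∀ k, 2 ≤ k → k ≤ N → ratio t k ≤ 40) {n : ℕ} (hn1 : 1 ≤ n) (hn : n ≤ N) :
    ∑ k ∈ Finset.range n, step t (k + 1) * normL2 ℓ (truncation T t u (k + 1)) ^ 2 ≤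
      (10 ^ 12 * (startTerms ℓ T t u n + mainTerm ℓ T t u n)) ^ 2 := by
  have hs1 := h.step_pos le_rfl (hn1.trans hn)
  have d1 := derivMass_nonneg (ℓ := ℓ) (u := u) h 2 (hn1.trans hn)
  have hm0 : 0 ≤ mainTerm ℓ T t u n := Real.sqrt_nonneg _
  have first : step t 1 * normL2 ℓ (truncation T t u 1) ^ 2 ≤
      4 * (step t 1 ^ (1 / 2 : ℝ) * derivMass ℓ T t u 2 1) ^ 2 := by
    have := hu.normL2_truncation_one h hT (hn1.trans hn)
    rw [← Real.sqrt_eq_rpow, mul_pow, Real.sq_sqrt hs1.le]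
    have h2 := pow_le_pow_left₀ (normL2_nonneg _) this 2
    nlinarith [mul_le_mul_of_nonneg_left h2 hs1.le]
  have hx : 0 ≤ step t 1 ^ (1 / 2 : ℝ) * derivMass ℓ T t u 2 1 := by positivity
  rcases n with _ | _ | m
  · omega
  · simp only [startTerms, zero_add, Finset.sum_range_one, Nat.not_ofNat_le_one, if_false, add_zero]
    have hm0' : 0 ≤ mainTerm ℓ T t u 1 := hm0
    nlinarith [mul_nonneg hx hm0', sq_nonneg (mainTerm ℓ T t u 1)]
  · have hN2 : 2 ≤ N := by omega
    have hs2 := h.step_pos (by norm_num : 1 ≤ 2) hN2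
    have d2 := derivMass_nonneg (ℓ := ℓ) (u := u) h 3 hN2
    have d3 := derivMass_nonneg (ℓ := ℓ) (u := u) h 3 (hn1.trans hn)
    have e2 : step t 2 ^ (3 / 2 : ℝ) * derivMass ℓ T t u 3 2 +
          step t 1 * step t 2 ^ (1 / 2 : ℝ) * derivMass ℓ T t u 3 1 =
        √(step t 2) * (step t 2 * derivMass ℓ T t u 3 2 + step t 1 * derivMass ℓ T t u 3 1) := by
      rw [show (3 / 2 : ℝ) = 1 + 1 / 2 by norm_num, Real.rpow_add hs2, Real.rpow_one,
        ← Real.sqrt_eq_rpow]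
      ring
    have second : step t 2 * normL2 ℓ (truncation T t u 2) ^ 2 ≤
        9 * (step t 2 ^ (3 / 2 : ℝ) * derivMass ℓ T t u 3 2 +
          step t 1 * step t 2 ^ (1 / 2 : ℝ) * derivMass ℓ T t u 3 1) ^ 2 := by
      have := hu.normL2_truncation_two h hT hN2
      rw [e2, mul_pow, Real.sq_sqrt hs2.le]
      have h2 := pow_le_pow_left₀ (normL2_nonneg _) this 2
      nlinarith [mul_le_mul_of_nonneg_left h2 hs2.le]
    have third : ∑ k ∈ Finset.range m, step t (k + 3) *
        normL2 ℓ (truncation T t u (k + 3)) ^ 2 ≤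
        (10 ^ 12) ^ 2 * mainTerm ℓ T t u (m + 2) ^ 2 := by
      rw [mainTerm, Real.sq_sqrt (Finset.sum_nonneg fun k hk => mul_nonneg
        (h.step_pos (by have := Finset.mem_Icc.1 hk; omega)
          (by have := Finset.mem_Icc.1 hk; omega)).le (sq_nonneg _)), sum_Icc_three, Finset.mul_sum]
      refine Finset.sum_le_sum fun k hk => ?_
      have hk' : k + 3 ≤ N := by have := Finset.mem_range.1 hk; omega
      have h1 := hu.normL2_truncation_add_three h hT hk' (hr _ (by omega) (by omega))
        (hr _ (by omega) hk')
      have h2 := pow_le_pow_left₀ (normL2_nonneg _) h1 2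
      have h3 := mul_le_mul_of_nonneg_left h2 (h.step_pos (by omega : 1 ≤ k + 3) hk').le
      refine h3.trans_eq ?_
      rw [show k + 3 - 1 = k + 2 from rfl, show k + 3 - 2 = k + 1 from rfl]
      ring
    have hy : 0 ≤ step t 2 ^ (3 / 2 : ℝ) * derivMass ℓ T t u 3 2 +
          step t 1 * step t 2 ^ (1 / 2 : ℝ) * derivMass ℓ T t u 3 1 := by positivity
    rw [Finset.sum_range_succ', Finset.sum_range_succ', startTerms, if_pos (by omega)]
    change ∑ k ∈ Finset.range m, step t (k + 3) * normL2 ℓ (truncation T t u (k + 3)) ^ 2 +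
      step t 2 * normL2 ℓ (truncation T t u 2) ^ 2 +
      step t 1 * normL2 ℓ (truncation T t u 1) ^ 2 ≤
      (10 ^ 12 * (_ + mainTerm ℓ T t u (m + 2))) ^ 2
    have hm0 : 0 ≤ mainTerm ℓ T t u (m + 2) := hm0
    generalize step t 1 ^ (1 / 2 : ℝ) * derivMass ℓ T t u 2 1 = x at *
    generalize step t 2 ^ (3 / 2 : ℝ) * derivMass ℓ T t u 3 2 +
          step t 1 * step t 2 ^ (1 / 2 : ℝ) * derivMass ℓ T t u 3 1 = y at *
    generalize mainTerm ℓ T t u (m + 2) = z at *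
    nlinarith [mul_nonneg hx hy, mul_nonneg hx hm0, mul_nonneg hy hm0, sq_nonneg x, sq_nonneg y]

end

end BDF3

end

theorem theorem5p2 :
    (∀ (T : ℝ) (N : ℕ) (t : ℕ → ℝ), BDF3.IsGrid T N t →
      (∀ k, 2 ≤ k → k ≤ N → BDF3.ratio t k ≤ 1.405) →
      BDF3.MatrixGT (BDF3.kernelMatrix t N) (BDF3.γ • (BDF3.stepMatrix t N)⁻¹)) ∧
    (∀ (d : ℕ), 1 ≤ d → d ≤ 3 → ∀ (ℓ : Fin d → ℝ), (∀ i, 0 < ℓ i) →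
      ∀ (ε T : ℝ), 0 < ε → 0 < T → ∀ (u₀ : EuclideanSpace ℝ (Fin d) → ℝ),
      ∃ C τmax : ℝ, 0 < C ∧ 0 < τmax ∧
        ∀ (N : ℕ) (t : ℕ → ℝ), BDF3.IsGrid T N t →
          (∀ k, 1 ≤ k → k ≤ N → BDF3.step t k ≤ τmax) →
          BDF3.MatrixGT (BDF3.kernelMatrix t N) (BDF3.γ • (BDF3.stepMatrix t N)⁻¹) →
          ∀ (u : ℝ → EuclideanSpace ℝ (Fin d) → ℝ), BDF3.IsSolution ℓ ε T u₀ u →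
          ∀ (v : ℕ → EuclideanSpace ℝ (Fin d) → ℝ),
            BDF3.IsDiscreteSolution ℓ ε u₀ N t v →
            ∀ n, 1 ≤ n → n ≤ N →
              BDF3.normL2 ℓ (fun x => u (t n) x - v n x) ≤
                C * (BDF3.startTerms ℓ T t u n + BDF3.mainTerm ℓ T t u n)) := by
  refine ⟨fun T N t h hr => BDF3.kernelMatrix_gt h hr, fun d _ _ ℓ hℓ ε T _ hT u₀ => ?_⟩
  obtain ⟨M, K, hM0, hK0, hMK⟩ := BDF3.exists_solution_bounds (ε := ε) hT hℓ u₀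
  have hγ : 0 < BDF3.γ := by norm_num [BDF3.γ]
  set L := 3 / BDF3.γ + K * (3 * M + 7) with hL
  have hLpos : 0 < L := by positivity
  set c := Real.exp (4 * L * T) / BDF3.γ with hc
  have hcpos : 0 < c := by positivity
  -- The step bound 1/(2L) is the Grönwall condition L τ ≤ 1/2. The factor √c is the root of the
  -- stability constant exp(4LT)/γ, and 10^12 comes from consistency.
  refine ⟨10 ^ 12 * √c, 1 / (2 * L), by positivity, by positivity, ?_⟩
  intro N t h hτ hB u hu v hv n hn1 hn
  have hstep : ∀ k, 1 ≤ k → k ≤ N → L * BDF3.step t k ≤ 1 / 2 := fun k h1 h2 => by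
    have := mul_le_mul_of_nonneg_left (hτ k h1 h2) hLpos.le
    refine this.trans_eq ?_
    field_simp
  have h1 := BDF3.normL2_error_sq_le hℓ h hu hv hγ hB hM0 hK0 (fun x hx => (hMK u hu x hx).1)
    (fun x hx => (hMK u hu x hx).2) hstep hn
  have h2 := BDF3.sum_truncation_le hT h hu (fun k hk2 hk => hB.ratio_le h hγ.le hk2 hk) hn1 hn
  have h3 : 0 ≤ BDF3.startTerms ℓ T t u n + BDF3.mainTerm ℓ T t u n :=
    add_nonneg (BDF3.startTerms_nonneg h hn1 hn) (Real.sqrt_nonneg _)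
  refine le_of_sq_le_sq ?_ (by positivity)
  calc _ ≤ _ := h1
    _ = c * ∑ k ∈ Finset.range n, BDF3.step t (k + 1) *
          BDF3.normL2 ℓ (BDF3.truncation T t u (k + 1)) ^ 2 := by rw [hc]; ring
    _ ≤ c * (10 ^ 12 * (BDF3.startTerms ℓ T t u n + BDF3.mainTerm ℓ T t u n)) ^ 2 := by gcongr
    _ = _ := by rw [mul_pow, mul_pow, mul_pow, Real.sq_sqrt hcpos.le]; ring
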